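/- Let $m$ be a positive integer and let $G(s)$ and $H(s)$ be proper real-rational $m\times m$ transfer function matrices. Here $X^*$ is the conjugate transpose of $X$, and $X\ge 0$ (resp. $X>0$) means that $X$ is Hermitian and positive semidefinite (resp. positive definite). $G$ is *negative imaginary (NI)* if (i) $G$ has no pole at $0$ and no pole in $\Re s>0$; (ii) $j\,(G(j\omega)-G(j\omega)^*)\ge 0$ for every $\omega>0$ such that $j\omega$ is not a pole of $G$; (iii) if $j\omega_0$ with $\omega_0>0$ is a pole of $G$, it is a simple pole and $\lim_{s\to j\omega_0}(s-j\omega_0)\,s\,G(s)\ge 0$. $H$ is *strictly negative imaginary (SNI)* if $H$ has no pole in $\Re s\ge 0$ and $j\,(H(j\omega)-H(j\omega)^*)>0$ for all $\omega>0$. The positive feedback interconnection of $G$ and $H$ joins minimal state-space realizations $\dot x_1=A_1x_1+B_1u_1,\ y_1=C_1x_1+D_1u_1$ of $G$ and $\dot x_2=A_2x_2+B_2u_2,\ y_2=C_2x_2+D_2u_2$ of $H$ by $u_1=y_2$, $u_2=y_1$. It is *internally stable* if it is well-posed ($I-D_1D_2$ is invertible) and all eigenvalues of the closed-loop system matrix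 in the state $(x_1,x_2)$ lie in the open left half-plane; this is required for all minimal realizations of $G$ and $H$ (which are understood to exist). **Corollary.** Let $G$ be NI and let $H$ be SNI, with $G(\infty)H(\infty)=0$ and $H(\infty)\ge 0$. Then all eigenvalues of $G(0)H(0)$ are real, and the positive feedback interconnection of $G$ and $H$ is internally stable if and only if $\lambda_{\max}(G(0)H(0))<1$, where $\lambda_{\max}$ denotes the largest eigenvalue. -/

import Mathlib

open Filter Topology
open scoped ComplexOrder

noncomputable section

namespace NegImag

/-- Square `m × m` real-rational transfer function matrices `G(s)`. -/
abbrev TransferMatrix (m : ℕ) := Matrix (Fin m) (Fin m) (RatFunc ℝ)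

namespace TransferMatrix

variable {m : ℕ}

/-- `G(s)` is proper: in every entry, the degree of the (reduced) numerator does not exceed the
degree of the denominator. -/
def IsProper (G : TransferMatrix m) : Prop :=
  ∀ i k, (G i k).num.natDegree ≤ (G i k).denom.natDegree

/-- The complex value `G(s)`. It is meaningful when `s` is not a pole of `G`. -/
def evalAt (G : TransferMatrix m) (s : ℂ) : Matrix (Fin m) (Fin m) ℂ :=
  G.map (RatFunc.eval (algebraMap ℝ ℂ) s)

/-- The DC gain `G(0)`, a real matrix. It is meaningful when `0` is not a pole of `G`. -/
def dcGain (G : TransferMatrix m) : Matrix (Fin m) (Fin m) ℝ :=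
  G.map (RatFunc.eval (RingHom.id ℝ) 0)

/-- The value `G(∞)` of a proper transfer function matrix: in each entry, the ratio of the
coefficients of `s ^ d` in numerator and denominator, where `d` is the degree of the denominator. -/
def atInfinity (G : TransferMatrix m) : Matrix (Fin m) (Fin m) ℝ :=
  G.map fun g => g.num.coeff g.denom.natDegree / g.denom.leadingCoeff

/-- The order of the pole at `s` of a scalar rational function (`0` if `s` is not a pole): the
multiplicity of `s` as a complex root of the reduced denominator. -/
def poleOrder (g : RatFunc ℝ) (s : ℂ) : ℕ :=
  (g.denom.map (algebraMap ℝ ℂ)).rootMultiplicity s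

/-- `s` is a pole of the matrix `G`, i.e. a pole of some entry. -/
def IsPole (G : TransferMatrix m) (s : ℂ) : Prop :=
  ∃ i k, 0 < poleOrder (G i k) s

/-- Negative imaginary transfer function matrices. -/
structure IsNegativeImaginary (G : TransferMatrix m) : Prop where
  no_pole_zero : ¬ G.IsPole 0
  no_pole_right : ∀ s : ℂ, 0 < s.re → ¬ G.IsPole s
  freq_nonneg : ∀ ω : ℝ, 0 < ω → ¬ G.IsPole (Complex.I * ω) →
    (Complex.I • (G.evalAt (Complex.I * ω) -
      (G.evalAt (Complex.I * ω)).conjTranspose)).PosSemidef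
  simple_pole : ∀ ω : ℝ, 0 < ω → ∀ i k, poleOrder (G i k) (Complex.I * ω) ≤ 1
  residue_nonneg : ∀ ω : ℝ, 0 < ω → G.IsPole (Complex.I * ω) →
    ∃ K : Matrix (Fin m) (Fin m) ℂ,
      Tendsto (fun s : ℂ => ((s - Complex.I * ω) * s) • G.evalAt s)
        (𝓝[≠] (Complex.I * ω)) (𝓝 K) ∧ K.PosSemidef

/-- Strictly negative imaginary transfer function matrices. -/
structure IsStrictlyNegativeImaginary (H : TransferMatrix m) : Prop where
  no_pole : ∀ s : ℂ, 0 ≤ s.re → ¬ H.IsPole s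
  freq_pos : ∀ ω : ℝ, 0 < ω →
    (Complex.I • (H.evalAt (Complex.I * ω) -
      (H.evalAt (Complex.I * ω)).conjTranspose)).PosDef

end TransferMatrix

/-- State-space data `x' = A x + B u`, `y = C x + D u` with `n` states, `m` inputs and `m`
outputs. -/
structure StateSpace (n m : ℕ) where
  A : Matrix (Fin n) (Fin n) ℝ
  B : Matrix (Fin n) (Fin m) ℝ
  C : Matrix (Fin m) (Fin n) ℝ
  D : Matrix (Fin m) (Fin m) ℝ

namespace StateSpace

variable {n m n₁ n₂ : ℕ}

/-- The transfer function matrix `C (s I - A)⁻¹ B + D`, computed over the field `ℝ(s)`. -/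
def transfer (S : StateSpace n m) : TransferMatrix m :=
  S.C.map (algebraMap ℝ (RatFunc ℝ)) *
      ((RatFunc.X : RatFunc ℝ) • (1 : Matrix (Fin n) (Fin n) (RatFunc ℝ)) -
        S.A.map (algebraMap ℝ (RatFunc ℝ)))⁻¹ *
      S.B.map (algebraMap ℝ (RatFunc ℝ)) +
    S.D.map (algebraMap ℝ (RatFunc ℝ))

/-- `S` is a minimal realization of `G`: it realizes `G`, and no realization of `G` has fewer
states. -/
def IsMinimalRealization (S : StateSpace n m) (G : TransferMatrix m) : Prop :=
  S.transfer = G ∧ ∀ (n' : ℕ) (S' : StateSpace n' m), S'.transfer = G → n ≤ n'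

/-- The positive feedback interconnection `u₁ = y₂`, `u₂ = y₁` is well-posed: the algebraic loop
`y₁ = C₁ x₁ + D₁ y₂`, `y₂ = C₂ x₂ + D₂ y₁` determines `y₁` and `y₂` uniquely. -/
def WellPosed (S₁ : StateSpace n₁ m) (S₂ : StateSpace n₂ m) : Prop :=
  IsUnit (1 - S₁.D * S₂.D)

/-- The system matrix of the positive feedback interconnection `u₁ = y₂`, `u₂ = y₁` in the state
`(x₁, x₂)`, obtained from `y₁ = (I - D₁ D₂)⁻¹ (C₁ x₁ + D₁ C₂ x₂)` and
`y₂ = (I - D₂ D₁)⁻¹ (D₂ C₁ x₁ + C₂ x₂)`. -/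
def closedLoop (S₁ : StateSpace n₁ m) (S₂ : StateSpace n₂ m) :
    Matrix (Fin n₁ ⊕ Fin n₂) (Fin n₁ ⊕ Fin n₂) ℝ :=
  Matrix.fromBlocks
    (S₁.A + S₁.B * (1 - S₂.D * S₁.D)⁻¹ * S₂.D * S₁.C)
    (S₁.B * (1 - S₂.D * S₁.D)⁻¹ * S₂.C)
    (S₂.B * (1 - S₁.D * S₂.D)⁻¹ * S₁.C)
    (S₂.A + S₂.B * (1 - S₁.D * S₂.D)⁻¹ * S₁.D * S₂.C)

end StateSpace

/-- The complex spectrum of a real square matrix. -/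
def complexSpectrum {ι : Type} [Fintype ι] [DecidableEq ι] (M : Matrix ι ι ℝ) : Set ℂ :=
  spectrum ℂ (M.map (algebraMap ℝ ℂ))

/-- All eigenvalues lie in the open left half-plane. -/
def IsHurwitz {ι : Type} [Fintype ι] [DecidableEq ι] (M : Matrix ι ι ℝ) : Prop :=
  ∀ μ ∈ complexSpectrum M, μ.re < 0

/-- The largest eigenvalue of a real matrix all of whose eigenvalues are real. -/
def lambdaMax {m : ℕ} (M : Matrix (Fin m) (Fin m) ℝ) : ℝ :=
  sSup (spectrum ℝ M)

/-- Internal stability of the positive feedback interconnection of `G` and `H`: minimal state-space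
realizations exist, and whichever of them are interconnected, the loop is well-posed and its
system matrix is Hurwitz. -/
def InternallyStable {m : ℕ} (G H : TransferMatrix m) : Prop :=
  (∃ (n₁ n₂ : ℕ) (S₁ : StateSpace n₁ m) (S₂ : StateSpace n₂ m),
    S₁.IsMinimalRealization G ∧ S₂.IsMinimalRealization H) ∧
  ∀ (n₁ n₂ : ℕ) (S₁ : StateSpace n₁ m) (S₂ : StateSpace n₂ m),
    S₁.IsMinimalRealization G → S₂.IsMinimalRealization H →
      S₁.WellPosed S₂ ∧ IsHurwitz (S₁.closedLoop S₂)

end NegImag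

end

noncomputable section

open Polynomial
open scoped Matrix

namespace NegImag

variable {m n n₁ n₂ : ℕ}

/-! The proof rests on dissipation. At every jω with ω > 0, an input u and its response y satisfy Im
u*y ≤ 0 for G, and Im u*y < 0 for H when u ≠ 0. For G this persists at imaginary poles
(`im_star_dotProduct_output_nonpos`), since solvability of the state equation there forces u into
the kernel of the residue. Around a positive feedback loop the two inequalities contradict each
other. Hence for no gain κ > 0 does the loop of G and κH have an eigenvalue jω with ω ≠ 0, and an
eigenvalue 0 requires κ G(0)H(0) y = y with y ≠ 0. Minimality ensures that eigenvalues of a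
realization are poles of its transfer matrix, and that a nonzero loop state produces a nonzero
signal.

Sufficiency: if G(0)H(0) has no eigenvalue in [1, ∞), no κ in (0, 1] puts a closed-loop eigenvalue
on the imaginary axis, so `IsHurwitz.of_path` carries stability from a small κ to κ = 1. Stability
at small κ is not a mere perturbation of κ = 0, because G may have imaginary poles.
`exists_isHurwitz_closedLoop_scale` obtains it by compactness: unstable eigenvalues would accumulate
at such a pole, where the sign of the residue and the strictness of H give a contradiction.

Necessity: for a stable loop, the map T from a disturbance r at the input of H to the output of H is
stable, has Im r*T(jω)r ≤ 0, and T(∞) = H(∞). Phragmén–Lindelöf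
(`dotProduct_le_re_transferForm_zero`) gives rᵀT(∞)r ≤ rᵀT(0)r. For G(0)H(0)v = l v and r = (1 - l)v
this reads (1 - l)² vᵀH(∞)v ≤ (1 - l) vᵀH(0)v. If l > 1, then H(0)v = 0; if l = 1, then r = 0 and
the response H(0)v vanishes too. Either way l v = 0.

The same inequality for H alone gives H(0) ≥ H(∞) ≥ 0; since G(0) is symmetric, the spectrum of
G(0)H(0) is real. -/

/-- The pencil `s I - A` of a real matrix `A` at a complex number `s`. -/
def pencil {ι : Type*} [DecidableEq ι] (A : Matrix ι ι ℝ) (s : ℂ) : Matrix ι ι ℂ :=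
  s • (1 : Matrix ι ι ℂ) - A.map (algebraMap ℝ ℂ)

/-- The value `C (s I - A)⁻¹ B + D` of the transfer function of real state-space data. -/
def transferValue {ι κ : Type*} [Fintype ι] [DecidableEq ι] (A : Matrix ι ι ℝ)
    (B : Matrix ι κ ℝ) (C : Matrix κ ι ℝ) (D : Matrix κ κ ℝ) (s : ℂ) : Matrix κ κ ℂ :=
  C.map (algebraMap ℝ ℂ) * (pencil A s)⁻¹ * B.map (algebraMap ℝ ℂ) + D.map (algebraMap ℝ ℂ)

/-- The polynomial numerator of `C (s I - A)⁻¹ B + D` over the denominator `det (s I - A)`. -/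
def transferNum {ι κ : Type*} [Fintype ι] [DecidableEq ι] (A : Matrix ι ι ℝ)
    (B : Matrix ι κ ℝ) (C : Matrix κ ι ℝ) (D : Matrix κ κ ℝ) : Matrix κ κ ℝ[X] :=
  C.map Polynomial.C * A.charmatrix.adjugate * B.map Polynomial.C +
    A.charpoly • D.map Polynomial.C

/-! ### Resolvents and transfer functions as quotients of polynomials -/

section Resolvent

variable {ι κ : Type*} [Fintype ι] [DecidableEq ι]

theorem mapMatrix_charmatrix {R : Type*} [CommRing R] (φ : ℝ[X] →+* R) (A : Matrix ι ι ℝ) :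
    φ.mapMatrix A.charmatrix =
      φ X • (1 : Matrix ι ι R) - A.map (fun a => φ (Polynomial.C a)) := by
  ext i j
  by_cases h : i = j
  · subst h
    simp
  · simp [h]

theorem inv_mapMatrix_charmatrix {K : Type*} [Field K] (φ : ℝ[X] →+* K) (A : Matrix ι ι ℝ) :
    (φ.mapMatrix A.charmatrix)⁻¹ =
      (φ A.charpoly)⁻¹ • φ.mapMatrix A.charmatrix.adjugate := by
  rw [Matrix.inv_def, ← RingHom.map_det, ← RingHom.map_adjugate, Ring.inverse_eq_inv']
  rfl

/-- Cramer's rule under an arbitrary ring map out of `ℝ[X]`. With `aeval s` it gives values at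
complex points, with `algebraMap` into `RatFunc ℝ` the transfer matrix itself, so both have the same
numerator and denominator. -/
theorem mul_inv_mapMatrix_charmatrix_mul_add {K : Type*} [Field K] (φ : ℝ[X] →+* K)
    (A : Matrix ι ι ℝ) (B : Matrix ι κ ℝ) (C : Matrix κ ι ℝ) (D : Matrix κ κ ℝ)
    (h : φ A.charpoly ≠ 0) :
    C.map (fun a => φ (Polynomial.C a)) * (φ.mapMatrix A.charmatrix)⁻¹ *
        B.map (fun a => φ (Polynomial.C a)) + D.map (fun a => φ (Polynomial.C a)) =
      (φ A.charpoly)⁻¹ • (transferNum A B C D).map φ := by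
  rw [inv_mapMatrix_charmatrix, transferNum, Matrix.map_add _ (map_add φ), Matrix.map_mul,
    Matrix.map_mul, Matrix.map_map, Matrix.map_map, Matrix.mul_smul, Matrix.smul_mul, smul_add]
  congr 1
  ext i j
  simp [h]

theorem pencil_eq_mapMatrix (A : Matrix ι ι ℝ) (s : ℂ) :
    pencil A s = (aeval s : ℝ[X] →ₐ[ℝ] ℂ).toRingHom.mapMatrix A.charmatrix := by
  rw [mapMatrix_charmatrix]
  ext i j
  simp [pencil]

theorem det_pencil (A : Matrix ι ι ℝ) (s : ℂ) : (pencil A s).det = aeval s A.charpoly := by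
  rw [pencil_eq_mapMatrix, ← RingHom.map_det]
  rfl

theorem inv_pencil_apply (A : Matrix ι ι ℝ) (s : ℂ) (i j : ι) :
    (pencil A s)⁻¹ i j = aeval s (A.charmatrix.adjugate i j) / aeval s A.charpoly := by
  rw [pencil_eq_mapMatrix, inv_mapMatrix_charmatrix, div_eq_inv_mul]
  simp

theorem transferValue_apply (A : Matrix ι ι ℝ) (B : Matrix ι κ ℝ) (C : Matrix κ ι ℝ)
    (D : Matrix κ κ ℝ) {s : ℂ} (h : aeval s A.charpoly ≠ 0) (i j : κ) :
    transferValue A B C D s i j = aeval s (transferNum A B C D i j) / aeval s A.charpoly := by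
  have := mul_inv_mapMatrix_charmatrix_mul_add (aeval s : ℝ[X] →ₐ[ℝ] ℂ).toRingHom A B C D h
  rw [← pencil_eq_mapMatrix] at this
  have h2 := congrFun (congrFun this i) j
  rw [div_eq_inv_mul]
  simpa [transferValue, Function.comp_def] using h2

theorem pencil_mulVec (A : Matrix ι ι ℝ) (s : ℂ) (v : ι → ℂ) :
    pencil A s *ᵥ v = s • v - A.map (algebraMap ℝ ℂ) *ᵥ v := by
  simp [pencil, Matrix.sub_mulVec, Matrix.smul_mulVec]

theorem mem_complexSpectrum_iff {ι : Type} [Fintype ι] [DecidableEq ι] (A : Matrix ι ι ℝ)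
    (s : ℂ) : s ∈ complexSpectrum A ↔ (pencil A s).det = 0 := by
  rw [complexSpectrum, Matrix.mem_spectrum_iff_isRoot_charpoly, Matrix.charpoly_map, det_pencil,
    IsRoot, eval_map_algebraMap]

theorem eventually_det_pencil_ne_zero (A : Matrix ι ι ℝ) (s₀ : ℂ) :
    ∀ᶠ s in 𝓝[≠] s₀, (pencil A s).det ≠ 0 := by
  have hfin : {s : ℂ | (pencil A s).det = 0}.Finite := by
    have hp : A.charpoly.map (algebraMap ℝ ℂ) ≠ 0 := (A.charpoly_monic.map _).ne_zero
    refine (A.charpoly.map (algebraMap ℝ ℂ)).roots.toFinset.finite_toSet.subset fun s hs => ?_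
    simp only [Set.mem_ofPred_eq, det_pencil] at hs
    simp [hp, hs]
  have := (hfin.subset (Set.sdiff_subset (t := {s₀}))).isClosed.isOpen_compl.mem_nhds
    (x := s₀) (by simp)
  filter_upwards [mem_nhdsWithin_of_mem_nhds this, self_mem_nhdsWithin] with s hs hne h
  exact hs ⟨h, hne⟩

theorem continuous_det_pencil (A : Matrix ι ι ℝ) : Continuous fun s => (pencil A s).det := by
  simp_rw [det_pencil]
  exact A.charpoly.continuous_aeval

theorem continuousAt_inv_pencil (A : Matrix ι ι ℝ) {s₀ : ℂ} (h : (pencil A s₀).det ≠ 0) :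
    ContinuousAt (fun s => (pencil A s)⁻¹) s₀ := by
  refine continuousAt_pi.2 fun i => continuousAt_pi.2 fun j => ?_
  simp_rw [inv_pencil_apply]
  rw [det_pencil] at h
  exact (Polynomial.continuous_aeval _).continuousAt.div
    (Polynomial.continuous_aeval _).continuousAt h

theorem continuousAt_transferValue (A : Matrix ι ι ℝ) (B : Matrix ι κ ℝ) (C : Matrix κ ι ℝ)
    (D : Matrix κ κ ℝ) {s₀ : ℂ} (h : (pencil A s₀).det ≠ 0) :
    ContinuousAt (transferValue A B C D) s₀ := by
  have h1 := continuousAt_inv_pencil A h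
  have h2 : Continuous fun M : Matrix ι ι ℂ =>
      C.map (algebraMap ℝ ℂ) * M * B.map (algebraMap ℝ ℂ) + D.map (algebraMap ℝ ℂ) := by
    fun_prop
  exact h2.continuousAt.comp h1

/-- With z = 1/s the resolvent is z (I - zA)⁻¹, which is continuous at z = 0 and vanishes there. -/
theorem tendsto_inv_pencil_cobounded (A : Matrix ι ι ℝ) :
    Tendsto (fun s => (pencil A s)⁻¹) (Bornology.cobounded ℂ) (𝓝 0) := by
  let F : ℂ → Matrix ι ι ℂ := fun z => 1 - z • A.map (algebraMap ℝ ℂ)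
  have hF : ContinuousAt (fun z => z • (F z)⁻¹) 0 := by
    have hdet : (F 0).det ≠ 0 := by simp [F]
    have hc : Continuous F := by fun_prop
    have : (fun z => (F z)⁻¹) = fun z => (F z).det⁻¹ • (F z).adjugate := by
      funext z
      rw [Matrix.inv_def, Ring.inverse_eq_inv']
    have h3 : ContinuousAt (fun z => (F z)⁻¹) 0 := by
      rw [this]
      exact (hc.matrix_det.continuousAt.inv₀ hdet).smul hc.matrix_adjugate.continuousAt
    exact continuousAt_id.smul h3
  have h0 : Tendsto (fun z => z • (F z)⁻¹) (𝓝 0) (𝓝 0) := by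
    simpa [ContinuousAt] using hF
  refine (h0.comp tendsto_inv₀_cobounded).congr' ?_
  have hne : ∀ᶠ s : ℂ in Bornology.cobounded ℂ, s ≠ 0 := by
    exact Bornology.isBounded_def.1 (Bornology.isBounded_singleton (x := (0 : ℂ)))
  filter_upwards [hne] with s hs
  have : pencil A s = s • F s⁻¹ := by
    simp [pencil, F, smul_sub, smul_smul, hs]
  rw [this, Function.comp_apply]
  -- In the singular case both inverses take their default value 0, so the identity needs no
  -- restriction on s.
  by_cases hd : IsUnit (F s⁻¹).det
  · have := Matrix.inv_smul' (A := F s⁻¹) (Units.mk0 s hs) hd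
    simpa [Units.smul_def] using this.symm
  · rw [Matrix.nonsing_inv_apply_not_isUnit _ hd, Matrix.nonsing_inv_apply_not_isUnit, smul_zero]
    rw [Matrix.det_smul]
    intro h
    exact hd (isUnit_of_mul_isUnit_right h)

theorem tendsto_transferValue_cobounded (A : Matrix ι ι ℝ) (B : Matrix ι κ ℝ) (C : Matrix κ ι ℝ)
    (D : Matrix κ κ ℝ) :
    Tendsto (transferValue A B C D) (Bornology.cobounded ℂ) (𝓝 (D.map (algebraMap ℝ ℂ))) := by
  have h2 : Continuous fun M : Matrix ι ι ℂ =>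
      C.map (algebraMap ℝ ℂ) * M * B.map (algebraMap ℝ ℂ) + D.map (algebraMap ℝ ℂ) := by
    fun_prop
  have := (h2.tendsto 0).comp (tendsto_inv_pencil_cobounded A)
  simp only [Matrix.mul_zero, Matrix.zero_mul, zero_add] at this
  exact this

end Resolvent

/-! ### Poles and values: transfer matrix against realization -/

/-- `RatFunc.eval` reads the reduced fraction. The reduced denominator divides q, so it cannot
vanish where q does not, and cross-multiplication identifies the values. -/
theorem denom_ne_zero_and_eval_eq_div {g : RatFunc ℝ} {p q : ℝ[X]}
    (h : g * algebraMap ℝ[X] (RatFunc ℝ) q = algebraMap ℝ[X] (RatFunc ℝ) p) {s : ℂ}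
    (hq : aeval s q ≠ 0) :
    aeval s g.denom ≠ 0 ∧ g.eval (algebraMap ℝ ℂ) s = aeval s p / aeval s q := by
  have hq0 : q ≠ 0 := by
    rintro rfl
    simp at hq
  have hg : g = algebraMap ℝ[X] (RatFunc ℝ) p / algebraMap ℝ[X] (RatFunc ℝ) q := by
    rw [eq_div_iff (by simpa using hq0), h]
  have hd : aeval s g.denom ≠ 0 := by
    obtain ⟨r, hr⟩ := hg ▸ RatFunc.denom_div_dvd p q
    intro h0
    apply hq
    rw [hr, map_mul, h0, zero_mul]
  have hpq : g.num * q = p * g.denom := by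
    apply RatFunc.algebraMap_injective ℝ
    have h1 := RatFunc.num_div_denom g
    have h2 : algebraMap ℝ[X] (RatFunc ℝ) g.denom ≠ 0 := by simpa using g.denom_ne_zero
    rw [div_eq_iff h2] at h1
    rw [map_mul, map_mul, ← h, h1]
    ring
  refine ⟨hd, ?_⟩
  have h3 := congrArg (aeval s) hpq
  rw [map_mul, map_mul] at h3
  rw [RatFunc.eval, ← aeval_def, ← aeval_def, div_eq_div_iff hd hq, h3]

theorem poleOrder_eq_zero_iff (g : RatFunc ℝ) (s : ℂ) :
    TransferMatrix.poleOrder g s = 0 ↔ aeval s g.denom ≠ 0 := by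
  have : g.denom.map (algebraMap ℝ ℂ) ≠ 0 := by
    simpa using g.denom_ne_zero
  rw [TransferMatrix.poleOrder, ← not_iff_not, ← ne_eq, ← Nat.pos_iff_ne_zero,
    Polynomial.rootMultiplicity_pos this, IsRoot, eval_map_algebraMap, not_not]

theorem not_isPole_iff (G : TransferMatrix m) (s : ℂ) :
    ¬ G.IsPole s ↔ ∀ i k, aeval s (G i k).denom ≠ 0 := by
  simp_rw [TransferMatrix.IsPole, not_exists, not_lt, nonpos_iff_eq_zero, poleOrder_eq_zero_iff]

theorem eventually_not_isPole (G : TransferMatrix m) (s₀ : ℂ) :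
    ∀ᶠ s in 𝓝[≠] s₀, ¬ G.IsPole s := by
  simp_rw [not_isPole_iff, eventually_all]
  intro i k
  have hp : (G i k).denom.map (algebraMap ℝ ℂ) ≠ 0 := by simpa using (G i k).denom_ne_zero
  have hfin : {s : ℂ | aeval s (G i k).denom = 0}.Finite := by
    refine ((G i k).denom.map (algebraMap ℝ ℂ)).roots.toFinset.finite_toSet.subset fun s hs => ?_
    simp only [Set.mem_ofPred_eq] at hs
    simpa [hp] using hs
  have := (hfin.subset (Set.sdiff_subset (t := {s₀}))).isClosed.isOpen_compl.mem_nhds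
    (x := s₀) (by simp)
  filter_upwards [mem_nhdsWithin_of_mem_nhds this, self_mem_nhdsWithin] with s hs hne h
  exact hs ⟨h, hne⟩

namespace StateSpace

/-- The value of the transfer function of `S` at a complex number. -/
def value (S : StateSpace n m) (s : ℂ) : Matrix (Fin m) (Fin m) ℂ :=
  transferValue S.A S.B S.C S.D s

theorem transfer_mul_charpoly (S : StateSpace n m) (i j : Fin m) :
    S.transfer i j * algebraMap ℝ[X] (RatFunc ℝ) S.A.charpoly =
      algebraMap ℝ[X] (RatFunc ℝ) (transferNum S.A S.B S.C S.D i j) := by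
  have hχ : algebraMap ℝ[X] (RatFunc ℝ) S.A.charpoly ≠ 0 := by
    simpa using S.A.charpoly_monic.ne_zero
  have h := mul_inv_mapMatrix_charmatrix_mul_add (algebraMap ℝ[X] (RatFunc ℝ)) S.A S.B S.C S.D hχ
  have h2 := congrFun (congrFun h i) j
  rw [mapMatrix_charmatrix] at h2
  have hc : ∀ a : ℝ, algebraMap ℝ[X] (RatFunc ℝ) (Polynomial.C a) = algebraMap ℝ (RatFunc ℝ) a :=
    fun a => rfl
  simp only [hc, RatFunc.algebraMap_X] at h2
  have h3 : S.transfer i j = (algebraMap ℝ[X] (RatFunc ℝ) S.A.charpoly)⁻¹ *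
      algebraMap ℝ[X] (RatFunc ℝ) (transferNum S.A S.B S.C S.D i j) := h2
  rw [h3]
  field_simp

theorem eval_transfer {S : StateSpace n m} {s : ℂ} (h : (pencil S.A s).det ≠ 0) (i j : Fin m) :
    aeval s (S.transfer i j).denom ≠ 0 ∧ S.transfer.evalAt s i j = S.value s i j := by
  rw [det_pencil] at h
  have := denom_ne_zero_and_eval_eq_div (S.transfer_mul_charpoly i j) h
  refine ⟨this.1, ?_⟩
  rw [value, transferValue_apply _ _ _ _ h, ← this.2]
  rfl

theorem evalAt_transfer {S : StateSpace n m} {s : ℂ} (h : (pencil S.A s).det ≠ 0) :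
    S.transfer.evalAt s = S.value s :=
  Matrix.ext fun i j => (eval_transfer h i j).2

end StateSpace

theorem evalAt_ofReal (G : TransferMatrix m) (x : ℝ) (i j : Fin m) :
    G.evalAt x i j = (((G i j).num.eval x / (G i j).denom.eval x : ℝ) : ℂ) := by
  simp only [TransferMatrix.evalAt, Matrix.map_apply, RatFunc.eval, ← aeval_def]
  have h (p : ℝ[X]) : aeval (x : ℂ) p = ((p.eval x : ℝ) : ℂ) := by
    simpa using (Polynomial.aeval_algebraMap_apply_eq_algebraMap_eval (A := ℂ) x p)
  rw [h, h]
  push_cast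
  rfl

theorem dcGain_map (G : TransferMatrix m) : G.dcGain.map (algebraMap ℝ ℂ) = G.evalAt 0 := by
  ext i j
  have := evalAt_ofReal G 0 i j
  simp only [Complex.ofReal_zero] at this
  rw [this]
  simp [TransferMatrix.dcGain, RatFunc.eval, coeff_zero_eq_eval_zero]

theorem tendsto_div_coeff {p q : ℝ[X]} (hq : q ≠ 0) (h : p.natDegree ≤ q.natDegree) :
    Tendsto (fun x => p.eval x / q.eval x) atTop
      (𝓝 (p.coeff q.natDegree / q.leadingCoeff)) := by
  rcases h.lt_or_eq with h | h
  · rw [coeff_eq_zero_of_natDegree_lt h, zero_div]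
    exact Polynomial.div_tendsto_atTop_zero_of_degree_lt p q (degree_lt_degree h)
  · rw [← h, coeff_natDegree]
    by_cases hp : p = 0
    · simp [hp]
    · apply Polynomial.div_tendsto_atTop_leadingCoeff_div_of_degree_eq
      rw [degree_eq_natDegree hp, degree_eq_natDegree hq, h]

theorem tendsto_ofReal_cobounded :
    Tendsto (fun x : ℝ => (x : ℂ)) atTop (Bornology.cobounded ℂ) := by
  rw [← tendsto_norm_atTop_iff_cobounded]
  simpa using tendsto_abs_atTop_atTop

theorem eventually_det_pencil_ne_zero_cobounded {ι : Type*} [Fintype ι] [DecidableEq ι]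
    (A : Matrix ι ι ℝ) : ∀ᶠ s in Bornology.cobounded ℂ, (pencil A s).det ≠ 0 := by
  have hp : A.charpoly.map (algebraMap ℝ ℂ) ≠ 0 := (A.charpoly_monic.map _).ne_zero
  refine Bornology.isBounded_def.1 (Set.Finite.isBounded
    ((A.charpoly.map (algebraMap ℝ ℂ)).roots.toFinset.finite_toSet.subset fun s hs => ?_))
  have hs' : (pencil A s).det = 0 := hs
  rw [det_pencil] at hs'
  simpa [hp] using hs'

/-- Both sides are the limit of the same function along s = x → +∞ on the real line. -/
theorem StateSpace.D_eq_atInfinity (S : StateSpace n m) (h : S.transfer.IsProper) :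
    S.D = S.transfer.atInfinity := by
  ext i j
  have h1 : Tendsto (fun x : ℝ => S.transfer.evalAt x i j) atTop
      (𝓝 ((S.transfer.atInfinity i j : ℝ) : ℂ)) := by
    simp_rw [evalAt_ofReal]
    exact (Complex.continuous_ofReal.tendsto _).comp
      (tendsto_div_coeff (S.transfer i j).denom_ne_zero (h i j))
  have h2 : Tendsto (fun x : ℝ => S.value x i j) atTop (𝓝 ((S.D i j : ℝ) : ℂ)) := by
    have := (tendsto_transferValue_cobounded S.A S.B S.C S.D).comp tendsto_ofReal_cobounded
    exact ((continuous_apply_apply i j).tendsto _).comp this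
  have h3 : ∀ᶠ x : ℝ in atTop, S.value x i j = S.transfer.evalAt x i j := by
    filter_upwards [tendsto_ofReal_cobounded.eventually
      (eventually_det_pencil_ne_zero_cobounded S.A)] with x hx
    rw [evalAt_transfer hx]
  exact_mod_cast tendsto_nhds_unique (h2.congr' h3) h1

/-! ### Controllability and observability of minimal realizations -/

/-- The pencil `s I - A` over the field of rational functions. -/
def ratPencil {ι : Type*} [DecidableEq ι] (A : Matrix ι ι ℝ) : Matrix ι ι (RatFunc ℝ) :=
  (RatFunc.X : RatFunc ℝ) • (1 : Matrix ι ι (RatFunc ℝ)) - A.map (algebraMap ℝ (RatFunc ℝ))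

theorem isUnit_det_ratPencil {ι : Type*} [Fintype ι] [DecidableEq ι] (A : Matrix ι ι ℝ) :
    IsUnit (ratPencil A).det := by
  have : ratPencil A = (algebraMap ℝ[X] (RatFunc ℝ)).mapMatrix A.charmatrix := by
    rw [mapMatrix_charmatrix, RatFunc.algebraMap_X]
    rfl
  rw [this, ← RingHom.map_det, isUnit_iff_ne_zero]
  simpa using (show A.charmatrix.det ≠ 0 from A.charpoly_monic.ne_zero)

theorem inv_ratPencil_mul_of_mul_eq {ι κ : Type*} [Fintype ι] [DecidableEq ι] [Fintype κ]
    [DecidableEq κ] {A : Matrix ι ι ℝ} {A' : Matrix κ κ ℝ} {J : Matrix ι κ ℝ}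
    (h : A * J = J * A') :
    (ratPencil A)⁻¹ * J.map (algebraMap ℝ (RatFunc ℝ)) =
      J.map (algebraMap ℝ (RatFunc ℝ)) * (ratPencil A')⁻¹ := by
  have h1 : ratPencil A * J.map (algebraMap ℝ (RatFunc ℝ)) =
      J.map (algebraMap ℝ (RatFunc ℝ)) * ratPencil A' := by
    have h2 := congrArg (fun M => M.map (algebraMap ℝ (RatFunc ℝ))) h
    simp only [Matrix.map_mul] at h2
    rw [ratPencil, ratPencil, Matrix.sub_mul, Matrix.mul_sub, h2, Matrix.smul_mul,
      Matrix.mul_smul, Matrix.one_mul, Matrix.mul_one]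
  calc _ = (ratPencil A)⁻¹ * (J.map (algebraMap ℝ (RatFunc ℝ)) * ratPencil A') *
        (ratPencil A')⁻¹ := by
        rw [Matrix.mul_assoc, Matrix.mul_nonsing_inv_cancel_right _ _ (isUnit_det_ratPencil A')]
    _ = _ := by
        rw [← h1, Matrix.nonsing_inv_mul_cancel_left _ _ (isUnit_det_ratPencil A)]

namespace StateSpace

theorem transfer_eq (S : StateSpace n m) : S.transfer =
    S.C.map (algebraMap ℝ (RatFunc ℝ)) * (ratPencil S.A)⁻¹ * S.B.map (algebraMap ℝ (RatFunc ℝ)) +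
      S.D.map (algebraMap ℝ (RatFunc ℝ)) := rfl

/-- When the columns of J form a basis of an A-invariant subspace containing the range of B, S' is
the restriction of S to that subspace. This is how a non-controllable realization is shortened. -/
theorem transfer_eq_of_intertwining {n' : ℕ} (S : StateSpace n m) (S' : StateSpace n' m)
    (J : Matrix (Fin n) (Fin n') ℝ) (hA : S.A * J = J * S'.A) (hB : S.B = J * S'.B)
    (hC : S'.C = S.C * J) (hD : S'.D = S.D) : S'.transfer = S.transfer := by
  rw [transfer_eq, transfer_eq, hB, hC, hD, Matrix.map_mul, Matrix.map_mul, Matrix.mul_assoc,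
    Matrix.mul_assoc _ (ratPencil S.A)⁻¹, ← Matrix.mul_assoc (ratPencil S.A)⁻¹,
    inv_ratPencil_mul_of_mul_eq hA]
  simp only [Matrix.mul_assoc]

/-- The state space data with all matrices transposed and inputs and outputs exchanged. -/
def dual (S : StateSpace n m) : StateSpace n m := ⟨S.Aᵀ, S.Cᵀ, S.Bᵀ, S.Dᵀ⟩

theorem transfer_dual (S : StateSpace n m) : S.dual.transfer = S.transferᵀ := by
  have : ratPencil S.Aᵀ = (ratPencil S.A)ᵀ := by
    simp [ratPencil, Matrix.transpose_map]
  rw [transfer_eq, transfer_eq]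
  simp only [dual, this, Matrix.transpose_add, Matrix.transpose_mul, Matrix.transpose_map,
    ← Matrix.transpose_nonsing_inv, Matrix.mul_assoc]

theorem IsMinimalRealization.dual {S : StateSpace n m} {G : TransferMatrix m}
    (h : S.IsMinimalRealization G) : S.dual.IsMinimalRealization Gᵀ := by
  refine ⟨by rw [transfer_dual, h.1], fun n' S' hS' => h.2 n' S'.dual ?_⟩
  rw [transfer_dual, hS', Matrix.transpose_transpose]

/-- Controllability of minimal realizations. -/
theorem IsMinimalRealization.eq_top_of_invariant {S : StateSpace n m} {G : TransferMatrix m}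
    (h : S.IsMinimalRealization G) (W : Submodule ℝ (Fin n → ℝ))
    (hA : ∀ v ∈ W, S.A *ᵥ v ∈ W) (hB : ∀ u, S.B *ᵥ u ∈ W) : W = ⊤ := by
  let b := Module.finBasis ℝ W
  let J : Matrix (Fin n) (Fin (Module.finrank ℝ W)) ℝ := Matrix.of fun i j => (b j : Fin n → ℝ) i
  have hJ (v : Fin n → ℝ) (hv : v ∈ W) : J *ᵥ (b.repr ⟨v, hv⟩) = v := by
    have := congrArg Subtype.val (b.sum_repr ⟨v, hv⟩)
    ext i
    have := congrFun this i
    simp only [Submodule.coe_sum, Submodule.coe_smul, Finset.sum_apply, Pi.smul_apply,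
      smul_eq_mul] at this
    rw [← this]
    simp [Matrix.mulVec, dotProduct, J, mul_comm]
  have hfac {κ : Type} [Fintype κ] [DecidableEq κ] (M : Matrix (Fin n) κ ℝ)
      (hM : ∀ k, M.col k ∈ W) :
      ∃ N : Matrix (Fin (Module.finrank ℝ W)) κ ℝ, M = J * N := by
    refine ⟨Matrix.of fun i k => b.repr ⟨M.col k, hM k⟩ i, ?_⟩
    ext i k
    exact (congrFun (hJ _ (hM k)) i).symm
  obtain ⟨A', hA'⟩ := hfac (S.A * J) fun k => hA _ (b k).2
  obtain ⟨B', hB'⟩ := hfac S.B fun k => by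
    simpa using hB (Pi.single k 1)
  -- The restriction of S to W realizes G with dim W states, so minimality gives n ≤ dim W.
  have := h.2 _ (⟨A', B', S.C * J, S.D⟩ : StateSpace _ m)
    ((transfer_eq_of_intertwining S _ J hA' hB' rfl rfl).trans h.1)
  apply Submodule.eq_top_of_finrank_eq
  apply le_antisymm (Submodule.finrank_le W)
  simpa using this

/-- Observability of minimal realizations. -/
theorem IsMinimalRealization.eq_top_of_invariant_dual {S : StateSpace n m} {G : TransferMatrix m}
    (h : S.IsMinimalRealization G) (W : Submodule ℝ (Fin n → ℝ))
    (hA : ∀ v ∈ W, v ᵥ* S.A ∈ W) (hC : ∀ u, u ᵥ* S.C ∈ W) : W = ⊤ := by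
  refine h.dual.eq_top_of_invariant W (fun v hv => ?_) fun u => ?_
  · simpa [StateSpace.dual, Matrix.mulVec_transpose] using hA v hv
  · simpa [StateSpace.dual, Matrix.mulVec_transpose] using hC u

end StateSpace

/-! ### Simple poles, and eigenvalues of minimal realizations -/

/-- At a simple pole g = f/(s - s₀) with f regular at s₀. Subtracting f(s₀)/(s - s₀) leaves a
difference quotient of f, with limit f'(s₀). -/
theorem exists_tendsto_eval_sub_div {g : RatFunc ℝ} {s₀ : ℂ}
    (h : TransferMatrix.poleOrder g s₀ ≤ 1) :
    ∃ a b : ℂ, Tendsto (fun s => g.eval (algebraMap ℝ ℂ) s - (s - s₀)⁻¹ * a) (𝓝[≠] s₀) (𝓝 b) ∧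
      (TransferMatrix.poleOrder g s₀ = 0 → a = 0) := by
  have he (s : ℂ) : g.eval (algebraMap ℝ ℂ) s = aeval s g.num / aeval s g.denom := rfl
  rcases Nat.le_one_iff_eq_zero_or_eq_one.1 h with h0 | h1
  · rw [poleOrder_eq_zero_iff] at h0
    refine ⟨0, aeval s₀ g.num / aeval s₀ g.denom, ?_, fun _ => rfl⟩
    simp only [mul_zero, sub_zero, he]
    exact (((Polynomial.continuous_aeval g.num).tendsto s₀).div
      ((Polynomial.continuous_aeval g.denom).tendsto s₀) h0).mono_left nhdsWithin_le_nhds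
  · have hd : g.denom.map (algebraMap ℝ ℂ) ≠ 0 := by simpa using g.denom_ne_zero
    obtain ⟨q, hq, hndvd⟩ := Polynomial.exists_eq_pow_rootMultiplicity_mul_and_not_dvd
      (g.denom.map (algebraMap ℝ ℂ)) hd s₀
    have h1' : (g.denom.map (algebraMap ℝ ℂ)).rootMultiplicity s₀ = 1 := h1
    rw [h1', pow_one] at hq
    have hq0 : q.eval s₀ ≠ 0 := fun h => hndvd (dvd_iff_isRoot.2 h)
    let f : ℂ → ℂ := fun s => aeval s g.num / q.eval s
    have hf : DifferentiableAt ℂ f s₀ :=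
      (Polynomial.differentiable_aeval g.num).differentiableAt.div q.differentiableAt hq0
    refine ⟨f s₀, deriv f s₀, ?_, fun h0 => by omega⟩
    refine (hasDerivAt_iff_tendsto_slope.1 hf.hasDerivAt).congr' ?_
    filter_upwards [self_mem_nhdsWithin] with s hs
    have hs' : s - s₀ ≠ 0 := sub_ne_zero.2 hs
    have h2 : aeval s g.denom = (s - s₀) * q.eval s := by
      rw [← eval_map_algebraMap, hq]
      simp
    rw [he, h2, slope_def_field]
    change (aeval s g.num / q.eval s - f s₀) / _ = _
    rw [mul_comm (s - s₀) (q.eval s), ← div_div, sub_div, inv_mul_eq_div]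

theorem exists_tendsto_evalAt_sub_smul {G : TransferMatrix m} {s₀ : ℂ}
    (h : ∀ i k, TransferMatrix.poleOrder (G i k) s₀ ≤ 1) :
    ∃ R b : Matrix (Fin m) (Fin m) ℂ,
      Tendsto (fun s => G.evalAt s - (s - s₀)⁻¹ • R) (𝓝[≠] s₀) (𝓝 b) ∧
      (¬ G.IsPole s₀ → R = 0) := by
  choose a b hab using fun i k => exists_tendsto_eval_sub_div (h i k)
  refine ⟨Matrix.of a, Matrix.of b, ?_, fun hp => ?_⟩
  · exact tendsto_pi_nhds.2 fun i => tendsto_pi_nhds.2 fun k => (hab i k).1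
  · ext i k
    refine (hab i k).2 ?_
    rw [poleOrder_eq_zero_iff]
    exact (not_isPole_iff G s₀).1 hp i k

theorem tendsto_sub_smul_of_tendsto_sub {E : Type*} [AddCommGroup E] [Module ℂ E]
    [TopologicalSpace E] [ContinuousAdd E] [ContinuousSMul ℂ E] {F : ℂ → E} {R b : E} {s₀ : ℂ}
    (h : Tendsto (fun s => F s - (s - s₀)⁻¹ • R) (𝓝[≠] s₀) (𝓝 b)) :
    Tendsto (fun s => (s - s₀) • F s) (𝓝[≠] s₀) (𝓝 R) := by
  have h0 : Tendsto (fun s : ℂ => s - s₀) (𝓝[≠] s₀) (𝓝 0) := by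
    have : Tendsto (fun s : ℂ => s - s₀) (𝓝 s₀) (𝓝 (s₀ - s₀)) :=
      (continuous_id.sub continuous_const).tendsto s₀
    rw [sub_self] at this
    exact this.mono_left nhdsWithin_le_nhds
  have h1 := (h0.smul h).add_const R
  rw [zero_smul, zero_add] at h1
  refine h1.congr' ?_
  filter_upwards [self_mem_nhdsWithin] with s hs
  have hs' : s - s₀ ≠ 0 := sub_ne_zero.2 hs
  rw [smul_sub, smul_smul, mul_inv_cancel₀ hs', one_smul, sub_add_cancel]

theorem inv_pencil_mulVec_pencil {ι : Type*} [Fintype ι] [DecidableEq ι] {A : Matrix ι ι ℝ}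
    {s : ℂ} (h : (pencil A s).det ≠ 0) (x : ι → ℂ) : (pencil A s)⁻¹ *ᵥ (pencil A s *ᵥ x) = x := by
  rw [Matrix.mulVec_mulVec, Matrix.nonsing_inv_mul _ (isUnit_iff_ne_zero.2 h), Matrix.one_mulVec]

theorem pencil_mulVec_inv_pencil {ι : Type*} [Fintype ι] [DecidableEq ι] {A : Matrix ι ι ℝ}
    {s : ℂ} (h : (pencil A s).det ≠ 0) (x : ι → ℂ) : pencil A s *ᵥ ((pencil A s)⁻¹ *ᵥ x) = x := by
  rw [Matrix.mulVec_mulVec, Matrix.mul_nonsing_inv _ (isUnit_iff_ne_zero.2 h), Matrix.one_mulVec]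

theorem inv_pencil_mul_map {ι : Type*} [Fintype ι] [DecidableEq ι] {A : Matrix ι ι ℝ}
    {s : ℂ} (h : (pencil A s).det ≠ 0) :
    (pencil A s)⁻¹ * A.map (algebraMap ℝ ℂ) = s • (pencil A s)⁻¹ - 1 := by
  have h1 := Matrix.nonsing_inv_mul _ (isUnit_iff_ne_zero.2 h)
  have h2 : A.map (algebraMap ℝ ℂ) = s • 1 - pencil A s := by simp [pencil]
  rw [h2, Matrix.mul_sub, h1, Matrix.mul_smul, Matrix.mul_one]

theorem map_mul_inv_pencil {ι : Type*} [Fintype ι] [DecidableEq ι] {A : Matrix ι ι ℝ}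
    {s : ℂ} (h : (pencil A s).det ≠ 0) :
    A.map (algebraMap ℝ ℂ) * (pencil A s)⁻¹ = s • (pencil A s)⁻¹ - 1 := by
  have h1 := Matrix.mul_nonsing_inv _ (isUnit_iff_ne_zero.2 h)
  have h2 : A.map (algebraMap ℝ ℂ) = s • 1 - pencil A s := by simp [pencil]
  rw [h2, Matrix.sub_mul, h1, Matrix.smul_mul, Matrix.one_mul]

/-- The vectors on which a family of matrices converges. -/
def convergenceSubmodule {κ ι : Type*} [Fintype ι] (l : Filter ℂ) (F : ℂ → Matrix κ ι ℂ) :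
    Submodule ℝ (ι → ℝ) where
  carrier := {v | ∃ L, Tendsto (fun s => F s *ᵥ (algebraMap ℝ ℂ ∘ v)) l (𝓝 L)}
  zero_mem' := ⟨0, by
    simpa using tendsto_const_nhds⟩
  add_mem' := by
    rintro v w ⟨L, hL⟩ ⟨M, hM⟩
    refine ⟨L + M, (hL.add hM).congr fun s => ?_⟩
    rw [← Matrix.mulVec_add]
    congr 1
    ext
    simp
  smul_mem' := by
    rintro c v ⟨L, hL⟩
    refine ⟨(c : ℂ) • L, (hL.const_smul (c : ℂ)).congr fun s => ?_⟩
    rw [← Matrix.mulVec_smul]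
    congr 1
    ext
    simp

theorem exists_tendsto_of_convergenceSubmodule_eq_top {κ ι : Type*} [Fintype ι] [DecidableEq ι]
    {l : Filter ℂ} {F : ℂ → Matrix κ ι ℂ} (h : convergenceSubmodule l F = ⊤) :
    ∃ L, Tendsto F l (𝓝 L) := by
  have h1 (j : ι) : ∃ L, Tendsto (fun s => (F s).col j) l (𝓝 L) := by
    obtain ⟨L, hL⟩ : Pi.single j (1 : ℝ) ∈ convergenceSubmodule l F := h ▸ Submodule.mem_top
    refine ⟨L, hL.congr fun s => ?_⟩
    have : (algebraMap ℝ ℂ) ∘ (Pi.single j (1 : ℝ)) = Pi.single j (1 : ℂ) := by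
      ext k
      by_cases hk : k = j
      · subst hk; simp
      · simp [hk]
    rw [this, Matrix.mulVec_single_one]
  choose L hL using h1
  exact ⟨Matrix.of fun i j => L j i, tendsto_pi_nhds.2 fun i => tendsto_pi_nhds.2 fun j =>
    (tendsto_pi_nhds.1 (hL j)) i⟩

theorem map_mulVec_comp {κ ι : Type*} [Fintype ι] (M : Matrix κ ι ℝ) (v : ι → ℝ) :
    (algebraMap ℝ ℂ) ∘ (M *ᵥ v) = M.map (algebraMap ℝ ℂ) *ᵥ (algebraMap ℝ ℂ ∘ v) := by
  ext i
  exact RingHom.map_mulVec (algebraMap ℝ ℂ) M v i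

/-- A factor for which the transfer function converges at a point also makes the resolvent of a
minimal realization converge. -/
theorem StateSpace.IsMinimalRealization.exists_tendsto_inv_pencil {S : StateSpace n m}
    {G : TransferMatrix m} (h : S.IsMinimalRealization G) {s₀ : ℂ} {φ : ℂ → ℂ} (hφ : Continuous φ)
    {L : Matrix (Fin m) (Fin m) ℂ}
    (hL : Tendsto (fun s => φ s • G.evalAt s) (𝓝[≠] s₀) (𝓝 L)) :
    ∃ P, Tendsto (fun s => φ s • (pencil S.A s)⁻¹) (𝓝[≠] s₀) (𝓝 P) := by
  have hdet := eventually_det_pencil_ne_zero S.A s₀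
  have hφ' : Tendsto φ (𝓝[≠] s₀) (𝓝 (φ s₀)) := (hφ.tendsto s₀).mono_left nhdsWithin_le_nhds
  have hid : Tendsto (fun s : ℂ => s) (𝓝[≠] s₀) (𝓝 s₀) := tendsto_id.mono_left nhdsWithin_le_nhds
  have hCB : Tendsto (fun s => (φ s • (S.C.map (algebraMap ℝ ℂ) * (pencil S.A s)⁻¹)) *
      S.B.map (algebraMap ℝ ℂ)) (𝓝[≠] s₀) (𝓝 (L - φ s₀ • S.D.map (algebraMap ℝ ℂ))) := by
    refine (hL.sub (hφ'.smul_const (S.D.map (algebraMap ℝ ℂ)))).congr' ?_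
    filter_upwards [hdet] with s hs
    rw [← h.1, evalAt_transfer hs, value, transferValue, smul_add, add_sub_cancel_right,
      Matrix.smul_mul]
  -- The real v for which φ(s) C (sI - A)⁻¹ v converges form a subspace. It contains the range of B,
  -- as φG converges, and it is A-invariant, as (sI - A)⁻¹A = s(sI - A)⁻¹ - I. Controllability makes
  -- it the whole space.
  obtain ⟨Q, hQ⟩ := exists_tendsto_of_convergenceSubmodule_eq_top <| h.eq_top_of_invariant
    (convergenceSubmodule (𝓝[≠] s₀) fun s =>
      φ s • (S.C.map (algebraMap ℝ ℂ) * (pencil S.A s)⁻¹)) (by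
    rintro v ⟨M, hM⟩
    refine ⟨_, ((hid.smul hM).sub (hφ'.smul_const
      (S.C.map (algebraMap ℝ ℂ) *ᵥ (algebraMap ℝ ℂ ∘ v)))).congr' ?_⟩
    filter_upwards [hdet] with s hs
    rw [map_mulVec_comp, Matrix.mulVec_mulVec, Matrix.smul_mul, Matrix.mul_assoc,
      inv_pencil_mul_map hs, Matrix.mul_sub, Matrix.mul_smul, Matrix.mul_one, smul_sub,
      Matrix.sub_mulVec, Matrix.smul_mulVec, Matrix.smul_mulVec, Matrix.smul_mulVec,
      Matrix.smul_mulVec, smul_comm]) (fun u => by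
    refine ⟨(L - φ s₀ • S.D.map (algebraMap ℝ ℂ)) *ᵥ (algebraMap ℝ ℂ ∘ u), ?_⟩
    simp_rw [map_mulVec_comp, Matrix.mulVec_mulVec]
    exact (((continuous_id.matrix_mulVec continuous_const).tendsto _).comp hCB))
  -- The same argument for row vectors, started from the rows of C by the limit Q, removes C by
  -- observability.
  obtain ⟨P, hP⟩ := exists_tendsto_of_convergenceSubmodule_eq_top <| h.eq_top_of_invariant_dual
    (convergenceSubmodule (𝓝[≠] s₀) fun s => (φ s • (pencil S.A s)⁻¹)ᵀ) (by
    rintro v ⟨M, hM⟩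
    refine ⟨_, ((hid.smul hM).sub (hφ'.smul_const (algebraMap ℝ ℂ ∘ v))).congr' ?_⟩
    filter_upwards [hdet] with s hs
    rw [← Matrix.mulVec_transpose, map_mulVec_comp, Matrix.mulVec_mulVec, Matrix.transpose_map,
      ← Matrix.transpose_mul, Matrix.mul_smul, map_mul_inv_pencil hs, smul_sub,
      Matrix.transpose_sub, Matrix.sub_mulVec, smul_comm]
    simp only [Matrix.transpose_smul, Matrix.smul_mulVec, Matrix.transpose_one,
      Matrix.one_mulVec]) (fun u => by
    refine ⟨Qᵀ *ᵥ (algebraMap ℝ ℂ ∘ u), ?_⟩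
    simp_rw [← Matrix.mulVec_transpose, map_mulVec_comp, Matrix.mulVec_mulVec,
      Matrix.transpose_map, ← Matrix.transpose_mul, Matrix.mul_smul]
    exact (((continuous_id.matrix_transpose.matrix_mulVec continuous_const).tendsto _).comp hQ))
  exact ⟨Pᵀ, (continuous_id.matrix_transpose.tendsto _).comp hP⟩

/-- With φ = 1 the resolvent has a limit P at a point that is not a pole, and (sI - A)(sI - A)⁻¹ = I
passes to the limit (s₀I - A)P = I. -/
theorem StateSpace.IsMinimalRealization.det_pencil_ne_zero {S : StateSpace n m}
    {G : TransferMatrix m} (h : S.IsMinimalRealization G) {s₀ : ℂ} (hs : ¬ G.IsPole s₀) :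
    (pencil S.A s₀).det ≠ 0 := by
  have h0 (i k) : TransferMatrix.poleOrder (G i k) s₀ = 0 := by
    rw [poleOrder_eq_zero_iff]
    exact (not_isPole_iff G s₀).1 hs i k
  obtain ⟨R, b, hb, hR⟩ := exists_tendsto_evalAt_sub_smul fun i k => (h0 i k).trans_le zero_le_one
  rw [hR hs] at hb
  obtain ⟨P, hP⟩ := h.exists_tendsto_inv_pencil (s₀ := s₀) (φ := fun _ => 1) continuous_const
    (L := b) (by simpa using hb)
  simp only [one_smul] at hP
  have hp : Continuous (pencil S.A) := by
    unfold pencil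
    fun_prop
  have h1 : Tendsto (fun s => pencil S.A s * (pencil S.A s)⁻¹) (𝓝[≠] s₀)
      (𝓝 (pencil S.A s₀ * P)) :=
    ((hp.tendsto s₀).mono_left nhdsWithin_le_nhds).mul hP
  have h2 : Tendsto (fun s => pencil S.A s * (pencil S.A s)⁻¹) (𝓝[≠] s₀) (𝓝 1) := by
    refine tendsto_const_nhds.congr' ?_
    filter_upwards [eventually_det_pencil_ne_zero S.A s₀] with s hs
    rw [Matrix.mul_nonsing_inv _ (isUnit_iff_ne_zero.2 hs)]
  have h3 := tendsto_nhds_unique h1 h2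
  intro h4
  have := congrArg Matrix.det h3
  rw [Matrix.det_mul, h4, zero_mul, Matrix.det_one] at this
  exact zero_ne_one this

/-! ### Dissipation on the imaginary axis, poles included -/

/-- Turns the matrix inequalities of the definitions into sign conditions on Im u*Mu, the form used
below. -/
theorem star_dotProduct_I_smul_sub {ι : Type*} [Fintype ι] (M : Matrix ι ι ℂ) (u : ι → ℂ) :
    star u ⬝ᵥ ((Complex.I • (M - Mᴴ)) *ᵥ u) = ((-2 * (star u ⬝ᵥ M *ᵥ u).im : ℝ) : ℂ) := by
  have h : star u ⬝ᵥ (Mᴴ *ᵥ u) = star (star u ⬝ᵥ M *ᵥ u) := by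
    rw [Matrix.star_dotProduct, Matrix.star_mulVec, Matrix.conjTranspose_conjTranspose,
      Matrix.dotProduct_mulVec]
  rw [Matrix.smul_mulVec, Matrix.sub_mulVec, dotProduct_smul, dotProduct_sub, h]
  apply Complex.ext <;> simp
  ring

theorem im_star_dotProduct_mulVec_nonpos {ι : Type*} [Fintype ι] {M : Matrix ι ι ℂ}
    (h : (Complex.I • (M - Mᴴ)).PosSemidef) (u : ι → ℂ) : (star u ⬝ᵥ M *ᵥ u).im ≤ 0 := by
  have := h.dotProduct_mulVec_nonneg u
  rw [star_dotProduct_I_smul_sub, Complex.zero_le_real] at this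
  linarith

theorem im_star_dotProduct_mulVec_neg {ι : Type*} [Fintype ι] {M : Matrix ι ι ℂ}
    (h : (Complex.I • (M - Mᴴ)).PosDef) {u : ι → ℂ} (hu : u ≠ 0) :
    (star u ⬝ᵥ M *ᵥ u).im < 0 := by
  have := h.dotProduct_mulVec_pos hu
  rw [star_dotProduct_I_smul_sub, Complex.zero_lt_real] at this
  linarith

/-- Popov–Belevitch–Hautus test: a minimal realization has no unobservable eigenvector. -/
theorem StateSpace.IsMinimalRealization.eq_zero_of_unobservable {S : StateSpace n m}
    {G : TransferMatrix m} (h : S.IsMinimalRealization G) {s : ℂ} {x : Fin n → ℂ}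
    (hA : pencil S.A s *ᵥ x = 0) (hC : S.C.map (algebraMap ℝ ℂ) *ᵥ x = 0) : x = 0 := by
  rw [pencil_mulVec, sub_eq_zero] at hA
  -- The kernel of v ↦ vᵀx is a real subspace even though x is complex, so observability over ℝ
  -- applies to complex eigenvectors.
  let f : (Fin n → ℝ) →ₗ[ℝ] ℂ :=
    { toFun := fun v => (algebraMap ℝ ℂ ∘ v) ⬝ᵥ x
      map_add' := fun v w => by
        rw [← add_dotProduct]
        congr 1
        ext
        simp
      map_smul' := fun c v => by
        rw [RingHom.id_apply, ← smul_dotProduct]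
        congr 1
        ext
        simp }
  have hvec {κ : Type} [Fintype κ] (M : Matrix κ (Fin n) ℝ) (v : κ → ℝ) :
      f (v ᵥ* M) = (algebraMap ℝ ℂ ∘ v) ⬝ᵥ (M.map (algebraMap ℝ ℂ) *ᵥ x) := by
    change (algebraMap ℝ ℂ ∘ (v ᵥ* M)) ⬝ᵥ x = _
    rw [← Matrix.mulVec_transpose, map_mulVec_comp, Matrix.transpose_map,
      Matrix.mulVec_transpose, Matrix.dotProduct_mulVec]
  have htop := h.eq_top_of_invariant_dual (LinearMap.ker f) (fun v hv => by
    rw [LinearMap.mem_ker] at hv ⊢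
    rw [hvec, ← hA, dotProduct_smul]
    exact (congrArg (s • ·) hv).trans (smul_zero s)) (fun u => by
    rw [LinearMap.mem_ker, hvec, hC, dotProduct_zero])
  ext j
  have hj : f (Pi.single j 1) = 0 := by
    rw [← LinearMap.mem_ker, htop]
    trivial
  have : (algebraMap ℝ ℂ) ∘ (Pi.single j (1 : ℝ)) = Pi.single j (1 : ℂ) := by
    ext k
    by_cases hk : k = j
    · subst hk; simp
    · simp [hk]
  change (algebraMap ℝ ℂ ∘ Pi.single j (1 : ℝ)) ⬝ᵥ x = 0 at hj
  rwa [this, single_one_dotProduct] at hj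

/-- If a row vector annihilates the input directions and is a left eigenvector for a minimal
realization, then it vanishes. -/
theorem StateSpace.IsMinimalRealization.eq_zero_of_uncontrollable {S : StateSpace n m}
    {G : TransferMatrix m} (h : S.IsMinimalRealization G) {s : ℂ} {x : Fin n → ℂ}
    (hA : x ᵥ* pencil S.A s = 0) (hB : x ᵥ* S.B.map (algebraMap ℝ ℂ) = 0) : x = 0 := by
  have hp : pencil S.dual.A s = (pencil S.A s)ᵀ := by
    simp [pencil, StateSpace.dual, Matrix.transpose_map]
  refine h.dual.eq_zero_of_unobservable (s := s) ?_ ?_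
  · rw [hp, Matrix.mulVec_transpose, hA]
  · change (S.Bᵀ).map _ *ᵥ x = 0
    rw [Matrix.transpose_map, Matrix.mulVec_transpose, hB]

/-- The limit K of the definition is jωR. Away from poles R = 0, so poles and regular points are
treated alike. -/
theorem TransferMatrix.IsNegativeImaginary.exists_residue {G : TransferMatrix m}
    (hG : G.IsNegativeImaginary) {ω : ℝ} (hω : 0 < ω) :
    ∃ R b : Matrix (Fin m) (Fin m) ℂ,
      Tendsto (fun s => G.evalAt s - (s - Complex.I * ω)⁻¹ • R) (𝓝[≠] (Complex.I * ω)) (𝓝 b) ∧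
      ((Complex.I * ω) • R).PosSemidef := by
  obtain ⟨R, b, hb, hR⟩ := exists_tendsto_evalAt_sub_smul (hG.simple_pole ω hω)
  refine ⟨R, b, hb, ?_⟩
  by_cases hp : G.IsPole (Complex.I * ω)
  · obtain ⟨K, hK, hpos⟩ := hG.residue_nonneg ω hω hp
    have h1 := tendsto_sub_smul_of_tendsto_sub hb
    have hid : Tendsto (fun s : ℂ => s) (𝓝[≠] (Complex.I * ω)) (𝓝 (Complex.I * ω)) :=
      tendsto_id.mono_left nhdsWithin_le_nhds
    have h2 := hid.smul h1
    simp_rw [smul_smul, mul_comm _ (_ - _)] at h2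
    rwa [tendsto_nhds_unique h2 hK]
  · rw [hR hp, smul_zero]
    exact Matrix.PosSemidef.zero

/-- On the positive imaginary axis, poles included, a minimal realization of a negative imaginary
transfer function matrix dissipates. -/
theorem StateSpace.IsMinimalRealization.im_star_dotProduct_output_nonpos {S : StateSpace n m}
    {G : TransferMatrix m} (h : S.IsMinimalRealization G) (hG : G.IsNegativeImaginary) {ω : ℝ}
    (hω : 0 < ω) {x : Fin n → ℂ} {u : Fin m → ℂ}
    (hx : pencil S.A (Complex.I * ω) *ᵥ x = S.B.map (algebraMap ℝ ℂ) *ᵥ u) :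
    (star u ⬝ᵥ (S.C.map (algebraMap ℝ ℂ) *ᵥ x + S.D.map (algebraMap ℝ ℂ) *ᵥ u)).im ≤ 0 := by
  obtain ⟨R, b, hb, hR⟩ := hG.exists_residue hω
  set s₀ : ℂ := Complex.I * ω with hs₀
  have hs₀0 : s₀ ≠ 0 := by simp [s₀, hω.ne']
  have hGR := tendsto_sub_smul_of_tendsto_sub hb
  have hdet := eventually_det_pencil_ne_zero S.A s₀
  have hsub : Continuous fun s : ℂ => s - s₀ := by fun_prop
  have hsub0 : Tendsto (fun s : ℂ => s - s₀) (𝓝[≠] s₀) (𝓝 0) := by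
    have := hsub.tendsto s₀
    rw [sub_self] at this
    exact this.mono_left nhdsWithin_le_nhds
  obtain ⟨P, hP⟩ := h.exists_tendsto_inv_pencil hsub hGR
  have hp : Tendsto (pencil S.A) (𝓝[≠] s₀) (𝓝 (pencil S.A s₀)) := by
    have : Continuous (pencil S.A) := by
      unfold pencil
      fun_prop
    exact (this.tendsto s₀).mono_left nhdsWithin_le_nhds
  -- P is the residue of the resolvent at s₀, and (s - s₀) I → 0.
  have hPp : P * pencil S.A s₀ = 0 := by
    have h1 := hP.mul hp
    refine tendsto_nhds_unique h1 ?_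
    have h2 := hsub0.smul_const (1 : Matrix (Fin n) (Fin n) ℂ)
    rw [zero_smul] at h2
    refine h2.congr' ?_
    filter_upwards [hdet] with s hs
    rw [Matrix.smul_mul, Matrix.nonsing_inv_mul _ (isUnit_iff_ne_zero.2 hs)]
  have hCPB : S.C.map (algebraMap ℝ ℂ) * P * S.B.map (algebraMap ℝ ℂ) = R := by
    have hc : Continuous fun M : Matrix (Fin n) (Fin n) ℂ =>
        S.C.map (algebraMap ℝ ℂ) * M * S.B.map (algebraMap ℝ ℂ) := by fun_prop
    have h1 := ((hc.tendsto P).comp hP).add (hsub0.smul_const (S.D.map (algebraMap ℝ ℂ)))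
    rw [zero_smul, add_zero] at h1
    refine tendsto_nhds_unique h1 (hGR.congr' ?_)
    filter_upwards [hdet] with s hs
    rw [← h.1, evalAt_transfer hs, value, transferValue, smul_add, Function.comp_apply,
      Matrix.mul_smul, Matrix.smul_mul]
  have hRu : R *ᵥ u = 0 := by
    rw [← hCPB, ← Matrix.mulVec_mulVec, ← hx, Matrix.mulVec_mulVec, Matrix.mul_assoc, hPp,
      Matrix.mul_zero, Matrix.zero_mulVec]
  -- s₀R is Hermitian, so its right kernel vectors are left kernel vectors.
  have huR : star u ᵥ* R = 0 := by
    have h1 : star u ᵥ* (s₀ • R) = 0 := by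
      rw [← hR.1.eq, ← Matrix.star_mulVec, Matrix.smul_mulVec, hRu, smul_zero, star_zero]
    rw [Matrix.vecMul_smul] at h1
    exact (smul_eq_zero.1 h1).resolve_left hs₀0
  have huCP : star u ᵥ* (S.C.map (algebraMap ℝ ℂ) * P) = 0 := by
    refine h.eq_zero_of_uncontrollable (s := s₀) ?_ ?_
    · rw [Matrix.vecMul_vecMul, Matrix.mul_assoc, hPp, Matrix.mul_zero, Matrix.vecMul_zero]
    · rw [Matrix.vecMul_vecMul, hCPB, huR]
  -- Since Bu = (sI - A)x - (s - s₀)x, G(s)u tends to C(x - Px) + Du even at a pole, and u*CP = 0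
  -- removes the residue term.
  have hlim : Tendsto (fun s => star u ⬝ᵥ (G.evalAt s *ᵥ u)) (𝓝[≠] s₀)
      (𝓝 (star u ⬝ᵥ (S.C.map (algebraMap ℝ ℂ) *ᵥ x + S.D.map (algebraMap ℝ ℂ) *ᵥ u))) := by
    have hc : Continuous fun M : Matrix (Fin n) (Fin n) ℂ =>
        star u ⬝ᵥ (S.C.map (algebraMap ℝ ℂ) *ᵥ (x - M *ᵥ x) +
          S.D.map (algebraMap ℝ ℂ) *ᵥ u) := by fun_prop
    have h1 := (hc.tendsto P).comp hP
    have h2 : star u ⬝ᵥ (S.C.map (algebraMap ℝ ℂ) *ᵥ (P *ᵥ x)) = 0 := by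
      rw [Matrix.mulVec_mulVec, Matrix.dotProduct_mulVec, huCP, zero_dotProduct]
    rw [Matrix.mulVec_sub, dotProduct_add, dotProduct_sub, h2, sub_zero, ← dotProduct_add] at h1
    refine h1.congr' ?_
    filter_upwards [hdet] with s hs
    have h3 : S.B.map (algebraMap ℝ ℂ) *ᵥ u = pencil S.A s *ᵥ x - (s - s₀) • x := by
      rw [← hx, pencil_mulVec, pencil_mulVec, sub_smul]
      abel
    rw [← h.1, evalAt_transfer hs, value, transferValue, Matrix.add_mulVec,
      ← Matrix.mulVec_mulVec, ← Matrix.mulVec_mulVec, h3, Matrix.mulVec_sub,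
      inv_pencil_mulVec_pencil hs, Matrix.mulVec_smul, Function.comp_apply, Matrix.smul_mulVec]
  have hI : Tendsto (fun w : ℝ => Complex.I * (w : ℂ)) (𝓝[≠] ω) (𝓝[≠] s₀) := by
    have hcont : Continuous fun w : ℝ => Complex.I * (w : ℂ) := by fun_prop
    refine tendsto_nhdsWithin_of_tendsto_nhds_of_eventually_within _
      ((hcont.tendsto ω).mono_left nhdsWithin_le_nhds) ?_
    filter_upwards [self_mem_nhdsWithin] with w hw hw'
    apply hw
    simpa [s₀] using hw'
  refine le_of_tendsto ((Complex.continuous_im.tendsto _).comp (hlim.comp hI)) ?_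
  have hpos : ∀ᶠ w : ℝ in 𝓝[≠] ω, 0 < w := mem_nhdsWithin_of_mem_nhds (lt_mem_nhds hω)
  filter_upwards [hpos, hI.eventually (eventually_not_isPole G s₀)] with w hw hnp
  exact im_star_dotProduct_mulVec_nonpos (hG.freq_nonneg w hw hnp) u

/-! ### DC gain against the value at infinity -/

theorem pencil_conj {ι : Type*} [DecidableEq ι] (A : Matrix ι ι ℝ) (s : ℂ) :
    pencil A (starRingEnd ℂ s) = (pencil A s).map (starRingEnd ℂ) := by
  ext i j
  by_cases h : i = j
  · subst h; simp [pencil]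
  · simp [pencil, h]

theorem det_pencil_conj {ι : Type*} [Fintype ι] [DecidableEq ι] (A : Matrix ι ι ℝ) (s : ℂ) :
    (pencil A (starRingEnd ℂ s)).det = starRingEnd ℂ (pencil A s).det := by
  rw [pencil_conj]
  exact (RingHom.map_det (starRingEnd ℂ) (pencil A s)).symm

theorem isHurwitz_iff {ι : Type} [Fintype ι] [DecidableEq ι] (A : Matrix ι ι ℝ) :
    IsHurwitz A ↔ ∀ s : ℂ, 0 ≤ s.re → (pencil A s).det ≠ 0 := by
  simp_rw [IsHurwitz, mem_complexSpectrum_iff]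
  exact forall_congr' fun s => by rw [← not_imp_not, not_lt]

section

variable {ι κ : Type*} [Fintype ι] [DecidableEq ι] [Fintype κ]

/-- The quadratic form of a transfer function at a real vector. -/
def transferForm (A : Matrix ι ι ℝ) (B : Matrix ι κ ℝ) (C : Matrix κ ι ℝ) (D : Matrix κ κ ℝ)
    (u : κ → ℝ) (s : ℂ) : ℂ :=
  (algebraMap ℝ ℂ ∘ u) ⬝ᵥ (transferValue A B C D s *ᵥ (algebraMap ℝ ℂ ∘ u))

variable (A : Matrix ι ι ℝ) (B : Matrix ι κ ℝ) (C : Matrix κ ι ℝ) (D : Matrix κ κ ℝ) (u : κ → ℝ)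

theorem transferForm_conj {s : ℂ} (h : (pencil A s).det ≠ 0) :
    transferForm A B C D u (starRingEnd ℂ s) = starRingEnd ℂ (transferForm A B C D u s) := by
  have h' : aeval s A.charpoly ≠ 0 := by rwa [← det_pencil]
  have h'' : aeval (starRingEnd ℂ s) A.charpoly ≠ 0 := by
    rw [← det_pencil, det_pencil_conj]
    simpa using h
  simp only [transferForm, dotProduct, Matrix.mulVec, map_sum, map_mul,
    transferValue_apply A B C D h', transferValue_apply A B C D h'', map_div₀]
  have h1 (p : ℝ[X]) : aeval (starRingEnd ℂ s) p = starRingEnd ℂ (aeval s p) :=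
    Polynomial.aeval_conj p s
  simp [h1]

theorem differentiableAt_transferForm {s : ℂ} (h : (pencil A s).det ≠ 0) :
    DifferentiableAt ℂ (transferForm A B C D u) s := by
  have hU : ∀ᶠ z in 𝓝 s, (pencil A z).det ≠ 0 :=
    (continuous_det_pencil A).continuousAt.eventually_ne h
  have heq : (fun z => ∑ i, (u i : ℂ) * ∑ j, aeval z (transferNum A B C D i j) /
      aeval z A.charpoly * (u j : ℂ)) =ᶠ[𝓝 s] transferForm A B C D u := by
    filter_upwards [hU] with z hz
    rw [det_pencil] at hz
    simp [transferForm, dotProduct, Matrix.mulVec, transferValue_apply A B C D hz]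
  refine DifferentiableAt.congr_of_eventuallyEq ?_ heq.symm
  rw [det_pencil] at h
  refine DifferentiableAt.fun_sum fun i _ => DifferentiableAt.const_mul ?_ _
  refine DifferentiableAt.fun_sum fun j _ => DifferentiableAt.mul_const ?_ _
  exact (Polynomial.differentiable_aeval _).differentiableAt.div
    (Polynomial.differentiable_aeval _).differentiableAt h

theorem tendsto_transferForm_cobounded :
    Tendsto (transferForm A B C D u) (Bornology.cobounded ℂ) (𝓝 ((u ⬝ᵥ D *ᵥ u : ℝ) : ℂ)) := by
  have hc : Continuous fun M : Matrix κ κ ℂ =>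
      (algebraMap ℝ ℂ ∘ u) ⬝ᵥ (M *ᵥ (algebraMap ℝ ℂ ∘ u)) := by fun_prop
  have := (hc.tendsto _).comp (tendsto_transferValue_cobounded A B C D)
  rw [← map_mulVec_comp] at this
  have h2 : (algebraMap ℝ ℂ ∘ u) ⬝ᵥ (algebraMap ℝ ℂ ∘ (D *ᵥ u)) = ((u ⬝ᵥ D *ᵥ u : ℝ) : ℂ) := by
    simp [dotProduct]
  rwa [h2] at this

variable {A}

/-- A stable real-rational function that is negative imaginary on the positive imaginary axis
has a DC gain that dominates its value at infinity. -/
theorem dotProduct_le_re_transferForm_zero (hA : ∀ s : ℂ, 0 ≤ s.re → (pencil A s).det ≠ 0)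
    (him : ∀ ω : ℝ, 0 < ω → (transferForm A B C D u (Complex.I * ω)).im ≤ 0) :
    u ⬝ᵥ D *ᵥ u ≤ (transferForm A B C D u 0).re := by
  set t := transferForm A B C D u with ht
  let U : Set ℂ := {s | (pencil A s).det ≠ 0}
  have hUo : IsOpen U := isOpen_ne_fun (continuous_det_pencil A) continuous_const
  have hU0 : U ∈ 𝓝 (0 : ℂ) := hUo.mem_nhds (hA 0 le_rfl)
  have htd : DifferentiableOn ℂ t U := fun s hs =>
    (differentiableAt_transferForm A B C D u hs).differentiableWithinAt
  -- The quotient q(s) = (t(s) - t(0))/s is analytic on the closed right half-plane and tends to 0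
  -- at infinity. On the axis Re q(jω) = Im t(jω)/ω ≤ 0, so |exp q| ≤ 1 there. Extending this bound
  -- to s = x > 0 gives t(x) ≤ t(0) in real parts, and x → ∞ concludes.
  have hg : DifferentiableOn ℂ (dslope t 0) U := (Complex.differentiableOn_dslope hU0).2 htd
  have hval {s : ℂ} (hs : s ≠ 0) : dslope t 0 s = (t s - t 0) / s := by
    rw [dslope_of_ne _ hs, slope_def_field, sub_zero]
  have ht0 : (t 0).im = 0 := by
    have := transferForm_conj A B C D u (hA 0 le_rfl)
    rw [map_zero] at this
    exact Complex.conj_eq_iff_im.1 this.symm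
  have hne : ∀ᶠ s : ℂ in Bornology.cobounded ℂ, s ≠ 0 :=
    Bornology.isBounded_def.1 (Bornology.isBounded_singleton (x := (0 : ℂ)))
  have hinf : Tendsto (dslope t 0) (Bornology.cobounded ℂ) (𝓝 0) := by
    have h1 := ((tendsto_transferForm_cobounded A B C D u).sub_const (t 0)).mul
      (tendsto_inv₀_cobounded (α := ℂ))
    rw [mul_zero] at h1
    refine h1.congr' ?_
    filter_upwards [hne] with s hs
    rw [hval hs, div_eq_mul_inv]
  have hexp : Tendsto (fun s => Complex.exp (dslope t 0 s)) (Bornology.cobounded ℂ) (𝓝 1) := by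
    have := (Complex.continuous_exp.tendsto 0).comp hinf
    rwa [Complex.exp_zero] at this
  have hpos {x : ℝ} (hx : 0 < x) : (dslope t 0 (x * Complex.I)).re ≤ 0 := by
    have hx' : (x : ℂ) * Complex.I ≠ 0 := by simp [hx.ne']
    have := him x hx
    rw [mul_comm] at this
    rw [hval hx', ← div_div, Complex.div_I]
    have h2 : ((t (x * Complex.I) - t 0) / (x : ℂ)).im = (t (x * Complex.I)).im / x := by
      rw [Complex.div_ofReal_im, Complex.sub_im, ht0, sub_zero]
    simp only [Complex.neg_re, Complex.mul_I_re, neg_neg, h2]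
    exact div_nonpos_of_nonpos_of_nonneg this hx.le
  have haxis (x : ℝ) : (dslope t 0 (x * Complex.I)).re ≤ 0 := by
    rcases lt_trichotomy x 0 with hx | rfl | hx
    · have h1 := hpos (neg_pos.2 hx)
      have hx' : ((-x : ℝ) : ℂ) * Complex.I ≠ 0 := by simp [hx.ne]
      have h2 : (x : ℂ) * Complex.I = starRingEnd ℂ (((-x : ℝ) : ℂ) * Complex.I) := by simp
      have hd : (pencil A (((-x : ℝ) : ℂ) * Complex.I)).det ≠ 0 := hA _ (by simp)
      have h3 : t (x * Complex.I) = starRingEnd ℂ (t (((-x : ℝ) : ℂ) * Complex.I)) := by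
        rw [h2]
        exact transferForm_conj A B C D u hd
      have h4 : t 0 = starRingEnd ℂ (t 0) := (Complex.conj_eq_iff_im.2 ht0).symm
      rw [hval (by simp [hx.ne]), h3, h4, h2, ← map_sub, ← map_div₀, Complex.conj_re, ← hval hx']
      exact h1
    · have hcont : ContinuousAt (dslope t 0) 0 := (hg.differentiableAt hU0).continuousAt
      have hc2 : Tendsto (fun x : ℝ => (x : ℂ) * Complex.I) (𝓝[>] 0) (𝓝 0) := by
        have : Continuous fun x : ℝ => (x : ℂ) * Complex.I := by fun_prop
        simpa using (this.tendsto 0).mono_left nhdsWithin_le_nhds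
      have h1 := (Complex.continuous_re.tendsto _).comp (hcont.tendsto.comp hc2)
      simp only [Complex.ofReal_zero, zero_mul]
      refine le_of_tendsto h1 ?_
      filter_upwards [self_mem_nhdsWithin] with x hx
      exact hpos hx
    · exact hpos hx
  have hre {x : ℝ} (hx : 0 < x) : (t x).re ≤ (t 0).re := by
    have hcl : closure {z : ℂ | 0 < z.re} ⊆ U := by
      rw [Complex.closure_setOfPred_lt_re]
      exact fun s hs => hA s hs
    have hdiff : DiffContOnCl ℂ (fun s => Complex.exp (dslope t 0 s)) {z : ℂ | 0 < z.re} :=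
      (hg.mono hcl).cexp.diffContOnCl
    -- The admissible growth is O(exp(0 · |z|¹)): exp q is bounded near infinity.
    have hb := PhragmenLindelof.right_half_plane_of_bounded_on_real (C := 1) (z := (x : ℂ)) hdiff
      ⟨1, one_lt_two, 0, by
        simp only [zero_mul, Real.exp_zero]
        exact (hexp.isBigO_one ℝ).mono inf_le_left⟩
      ((hexp.norm.comp tendsto_ofReal_cobounded).isBoundedUnder_le)
      (fun y => by
        rw [Complex.norm_exp]
        exact Real.exp_le_one_iff.2 (haxis y)) (by simpa using hx.le)
    rw [Complex.norm_exp, Real.exp_le_one_iff, hval (by simpa using hx.ne'),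
      Complex.div_ofReal_re, Complex.sub_re] at hb
    have := (div_le_iff₀ hx).1 hb
    linarith
  have hlim := (Complex.continuous_re.tendsto _).comp
    ((tendsto_transferForm_cobounded A B C D u).comp tendsto_ofReal_cobounded)
  refine le_of_tendsto hlim ?_
  filter_upwards [eventually_gt_atTop 0] with x hx
  exact hre hx

end

/-! ### Continuity of eigenvalues and stability along a path -/

theorem norm_mulVec_le_sum {ι κ : Type*} [Fintype ι] [Fintype κ] (M : Matrix κ ι ℂ) (v : ι → ℂ) :
    ‖M *ᵥ v‖ ≤ (∑ i, ∑ j, ‖M i j‖) * ‖v‖ := by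
  refine (pi_norm_le_iff_of_nonneg (by positivity)).2 fun i => ?_
  calc ‖(M *ᵥ v) i‖ ≤ ∑ j, ‖M i j * v j‖ := norm_sum_le _ _
    _ ≤ ∑ j, ‖M i j‖ * ‖v‖ := Finset.sum_le_sum fun j _ => by
        rw [norm_mul]
        exact mul_le_mul_of_nonneg_left (norm_le_pi_norm v j) (norm_nonneg _)
    _ = (∑ j, ‖M i j‖) * ‖v‖ := (Finset.sum_mul ..).symm
    _ ≤ _ := by
        refine mul_le_mul_of_nonneg_right ?_ (norm_nonneg _)
        exact Finset.single_le_sum (f := fun i => ∑ j, ‖M i j‖) (fun i _ => by positivity)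
          (Finset.mem_univ i)

theorem pow_card_le_norm_prod {r : ℝ} (hr : 0 ≤ r) (S : Multiset ℂ) (h : ∀ x ∈ S, r ≤ ‖x‖) :
    r ^ S.card ≤ ‖S.prod‖ := by
  induction S using Multiset.induction with
  | empty => simp
  | cons a S ih =>
    rw [Multiset.card_cons, Multiset.prod_cons, norm_mul, pow_succ']
    exact mul_le_mul (h a (Multiset.mem_cons_self a S))
      (ih fun x hx => h x (Multiset.mem_cons_of_mem hx)) (pow_nonneg hr _) (norm_nonneg _)

section

variable {ι : Type*} [Fintype ι] [DecidableEq ι]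

theorem exists_pencil_mulVec_eq_zero {A : Matrix ι ι ℝ} {s : ℂ} (h : (pencil A s).det = 0) :
    ∃ v : ι → ℂ, v ≠ 0 ∧ pencil A s *ᵥ v = 0 := Matrix.exists_mulVec_eq_zero_iff.2 h

theorem norm_le_sum_of_det_pencil_eq_zero {A : Matrix ι ι ℝ} {s : ℂ}
    (h : (pencil A s).det = 0) : ‖s‖ ≤ ∑ i, ∑ j, |A i j| := by
  obtain ⟨v, hv, hAv⟩ := exists_pencil_mulVec_eq_zero h
  rw [pencil_mulVec, sub_eq_zero] at hAv
  have h1 := norm_mulVec_le_sum (A.map (algebraMap ℝ ℂ)) v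
  rw [← hAv, norm_smul] at h1
  simpa using le_of_mul_le_mul_right h1 (norm_pos_iff.2 hv)

/-- A point at which the characteristic polynomial is small is close to an eigenvalue. -/
theorem exists_det_pencil_eq_zero_of_norm_lt {A : Matrix ι ι ℝ} {s : ℂ} {r : ℝ} (hr : 0 ≤ r)
    (h : ‖(pencil A s).det‖ < r ^ Fintype.card ι) :
    ∃ z : ℂ, ‖s - z‖ < r ∧ (pencil A z).det = 0 := by
  by_contra! hcon
  set p := A.charpoly.map (algebraMap ℝ ℂ) with hp
  have hm : p.Monic := A.charpoly_monic.map _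
  have hs : p.Splits := IsAlgClosed.splits p
  have hdet : (pencil A s).det = (p.roots.map (s - ·)).prod := by
    rw [det_pencil, ← eval_map_algebraMap, ← hp, hs.eval_eq_prod_roots_of_monic hm]
  have hcard : (p.roots.map (s - ·)).card = Fintype.card ι := by
    rw [Multiset.card_map, ← hs.natDegree_eq_card_roots, hp, A.charpoly_monic.natDegree_map,
      Matrix.charpoly_natDegree_eq_dim]
  rw [hdet, ← hcard] at h
  refine absurd (pow_card_le_norm_prod hr _ fun x hx => ?_) (not_le.2 h)
  obtain ⟨z, hz, rfl⟩ := Multiset.mem_map.1 hx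
  by_contra! hlt
  refine hcon z hlt ?_
  rw [det_pencil, ← eval_map_algebraMap]
  exact (mem_roots'.1 hz).2

theorem continuous_det_pencil_uncurry {M : ℝ → Matrix ι ι ℝ} (hM : Continuous M) :
    Continuous fun p : ℝ × ℂ => (pencil (M p.1) p.2).det := by
  refine Continuous.matrix_det ?_
  unfold pencil
  have : Continuous fun p : ℝ × ℂ => (M p.1).map (algebraMap ℝ ℂ) :=
    (hM.comp continuous_fst).matrix_map Complex.continuous_ofReal
  fun_prop

end

/-- Along a continuous path of real matrices without eigenvalues on the imaginary axis, stability
is preserved. -/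
theorem IsHurwitz.of_path {ι : Type} [Fintype ι] [DecidableEq ι] {M : ℝ → Matrix ι ι ℝ}
    (hM : Continuous M) {a b : ℝ} (hab : a ≤ b)
    (hax : ∀ κ ∈ Set.Icc a b, ∀ s : ℂ, s.re = 0 → (pencil (M κ) s).det ≠ 0)
    (ha : IsHurwitz (M a)) : IsHurwitz (M b) := by
  have hf := continuous_det_pencil_uncurry hM
  have hsum : Continuous fun κ => ∑ i, ∑ j, |M κ i j| := by fun_prop
  obtain ⟨R, hR⟩ := (isCompact_Icc (a := a) (b := b)).bddAbove_image hsum.continuousOn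
  -- `T` and `V` collect the parameters with an eigenvalue in the closed, resp. open, right
  -- half-plane. `T` is closed as the projection of a compact set, all eigenvalues being bounded by
  -- R; `V` is open because roots move continuously. Without eigenvalues on the axis they agree on
  -- [a, b], so connectedness keeps the path out of both.
  let T : Set ℝ := Prod.fst '' ((Set.Icc a b ×ˢ Metric.closedBall (0 : ℂ) R) ∩
    {p : ℝ × ℂ | 0 ≤ p.2.re ∧ (pencil (M p.1) p.2).det = 0})
  have hT : IsClosed T := by
    refine IsCompact.isClosed (IsCompact.image ?_ continuous_fst)
    refine (isCompact_Icc.prod (isCompact_closedBall 0 R)).inter_right ?_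
    exact (isClosed_le continuous_const (Complex.continuous_re.comp continuous_snd)).inter
      (isClosed_eq hf continuous_const)
  have hmemT {κ : ℝ} (hκ : κ ∈ Set.Icc a b) {s : ℂ} (hs : 0 ≤ s.re)
      (h0 : (pencil (M κ) s).det = 0) : κ ∈ T := by
    refine ⟨(κ, s), ⟨⟨hκ, ?_⟩, hs, h0⟩, rfl⟩
    rw [mem_closedBall_zero_iff]
    exact (norm_le_sum_of_det_pencil_eq_zero h0).trans (hR ⟨κ, hκ, rfl⟩)
  let V : Set ℝ := {κ | ∃ s : ℂ, 0 < s.re ∧ (pencil (M κ) s).det = 0}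
  have hV : IsOpen V := by
    rw [isOpen_iff_mem_nhds]
    rintro κ ⟨s, hs, h0⟩
    have hc : Continuous fun κ' => ‖(pencil (M κ') s).det‖ :=
      (hf.comp (continuous_id.prodMk continuous_const)).norm
    -- The radius Re s keeps the nearby root in the open right half-plane.
    have := hc.continuousAt.eventually_lt (continuousAt_const (y := s.re ^ Fintype.card ι))
      (x₀ := κ) (by simpa [h0] using pow_pos hs _)
    filter_upwards [this] with κ' hκ'
    obtain ⟨z, hz, hz0⟩ := exists_det_pencil_eq_zero_of_norm_lt hs.le hκ'
    refine ⟨z, ?_, hz0⟩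
    have := (Complex.re_le_norm (s - z)).trans_lt hz
    rw [Complex.sub_re] at this
    linarith
  rw [isHurwitz_iff]
  intro s hs h0
  have hsV {κ : ℝ} (hκ : κ ∈ Set.Icc a b) {s : ℂ} (hs : 0 ≤ s.re)
      (h0 : (pencil (M κ) s).det = 0) : κ ∈ V :=
    ⟨s, lt_of_le_of_ne hs fun h => hax κ hκ s h.symm h0, h0⟩
  have hb : b ∈ Set.Icc a b := Set.right_mem_Icc.2 hab
  have ha' : a ∈ Tᶜ := by
    rintro ⟨⟨κ, z⟩, ⟨-, hz, hz0⟩, rfl⟩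
    exact (isHurwitz_iff _).1 ha z hz hz0
  obtain ⟨κ, hκ, hκT, z, hz, hz0⟩ := isPreconnected_Icc Tᶜ V hT.isOpen_compl hV (fun κ hκ => by
    by_cases h : κ ∈ T
    · obtain ⟨⟨κ', z⟩, ⟨-, hz, hz0⟩, rfl⟩ := h
      exact Or.inr (hsV hκ hz hz0)
    · exact Or.inl h) ⟨a, Set.left_mem_Icc.2 hab, ha'⟩ ⟨b, hb, hsV hb hs h0⟩
  exact hκT (hmemT hκ hz.le hz0)

/-! ### Signals in the feedback loop -/

theorem mul_inv_pencil_mulVec {ι κ : Type*} [Fintype ι] [DecidableEq ι] [Fintype κ]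
    {A : Matrix ι ι ℝ} {B : Matrix ι κ ℝ} (C : Matrix κ ι ℝ) (D : Matrix κ κ ℝ) {s : ℂ}
    (h : (pencil A s).det ≠ 0) {x : ι → ℂ} {u : κ → ℂ}
    (hx : pencil A s *ᵥ x = B.map (algebraMap ℝ ℂ) *ᵥ u) :
    transferValue A B C D s *ᵥ u =
      C.map (algebraMap ℝ ℂ) *ᵥ x + D.map (algebraMap ℝ ℂ) *ᵥ u := by
  rw [transferValue, Matrix.add_mulVec, ← Matrix.mulVec_mulVec, ← Matrix.mulVec_mulVec, ← hx,
    inv_pencil_mulVec_pencil h]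

theorem map_mul_mulVec {ι κ μ : Type*} [Fintype ι] [Fintype κ] (M : Matrix μ κ ℝ)
    (N : Matrix κ ι ℝ) (v : ι → ℂ) : (M * N).map (algebraMap ℝ ℂ) *ᵥ v =
      M.map (algebraMap ℝ ℂ) *ᵥ (N.map (algebraMap ℝ ℂ) *ᵥ v) := by
  rw [Matrix.map_mul, Matrix.mulVec_mulVec]

theorem map_add_mulVec {ι κ : Type*} [Fintype ι] (M N : Matrix κ ι ℝ) (v : ι → ℂ) :
    (M + N).map (algebraMap ℝ ℂ) *ᵥ v =
      M.map (algebraMap ℝ ℂ) *ᵥ v + N.map (algebraMap ℝ ℂ) *ᵥ v := by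
  rw [Matrix.map_add _ (map_add _), Matrix.add_mulVec]

namespace StateSpace

/-- Scaling of the output of a system by a real gain. -/
def scale (κ : ℝ) (S : StateSpace n m) : StateSpace n m := ⟨S.A, S.B, κ • S.C, κ • S.D⟩

theorem scale_one (S : StateSpace n m) : S.scale 1 = S := by simp [scale]

variable {S₁ : StateSpace n₁ m} {S₂ : StateSpace n₂ m}

/-- The input matrix of the closed loop for a disturbance at the input of the second system. -/
def loopInput (S₁ : StateSpace n₁ m) (S₂ : StateSpace n₂ m) :
    Matrix (Fin n₁ ⊕ Fin n₂) (Fin m) ℝ := Matrix.fromRows (S₁.B * S₂.D) S₂.B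

/-- The output matrix of the closed loop for the output of the second system. -/
def loopOutput (S₁ : StateSpace n₁ m) (S₂ : StateSpace n₂ m) :
    Matrix (Fin m) (Fin n₁ ⊕ Fin n₂) ℝ := Matrix.fromCols (S₂.D * S₁.C) S₂.C

theorem closedLoop_eq (h12 : S₁.D * S₂.D = 0) (h21 : S₂.D * S₁.D = 0) :
    S₁.closedLoop S₂ = Matrix.fromBlocks (S₁.A + S₁.B * S₂.D * S₁.C) (S₁.B * S₂.C)
      (S₂.B * S₁.C) (S₂.A + S₂.B * S₁.D * S₂.C) := by
  simp [closedLoop, h12, h21]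

/-- The closed-loop state equation in terms of the internal signals. -/
theorem pencil_closedLoop_mulVec_iff (h12 : S₁.D * S₂.D = 0) (h21 : S₂.D * S₁.D = 0) {s : ℂ}
    {x₁ : Fin n₁ → ℂ} {x₂ : Fin n₂ → ℂ} {r y₁ y₂ : Fin m → ℂ}
    (hy₁ : y₁ = S₁.C.map (algebraMap ℝ ℂ) *ᵥ x₁ + S₁.D.map (algebraMap ℝ ℂ) *ᵥ y₂)
    (hy₂ : y₂ = S₂.C.map (algebraMap ℝ ℂ) *ᵥ x₂ + S₂.D.map (algebraMap ℝ ℂ) *ᵥ (y₁ + r)) :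
    (pencil (S₁.closedLoop S₂) s *ᵥ Sum.elim x₁ x₂ =
        (loopInput S₁ S₂).map (algebraMap ℝ ℂ) *ᵥ r ↔
      pencil S₁.A s *ᵥ x₁ = S₁.B.map (algebraMap ℝ ℂ) *ᵥ y₂ ∧
        pencil S₂.A s *ᵥ x₂ = S₂.B.map (algebraMap ℝ ℂ) *ᵥ (y₁ + r)) ∧
    (loopOutput S₁ S₂).map (algebraMap ℝ ℂ) *ᵥ Sum.elim x₁ x₂ +
      S₂.D.map (algebraMap ℝ ℂ) *ᵥ r = y₂ := by
  have hD12 (v : Fin m → ℂ) :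
      S₁.D.map (algebraMap ℝ ℂ) *ᵥ (S₂.D.map (algebraMap ℝ ℂ) *ᵥ v) = 0 := by
    rw [← map_mul_mulVec, h12]; simp
  have hD21 (v : Fin m → ℂ) :
      S₂.D.map (algebraMap ℝ ℂ) *ᵥ (S₁.D.map (algebraMap ℝ ℂ) *ᵥ v) = 0 := by
    rw [← map_mul_mulVec, h21]; simp
  have e1 : S₁.D.map (algebraMap ℝ ℂ) *ᵥ y₂ =
      S₁.D.map (algebraMap ℝ ℂ) *ᵥ (S₂.C.map (algebraMap ℝ ℂ) *ᵥ x₂) := by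
    rw [hy₂, Matrix.mulVec_add, hD12, add_zero]
  have e2 : S₂.D.map (algebraMap ℝ ℂ) *ᵥ y₁ =
      S₂.D.map (algebraMap ℝ ℂ) *ᵥ (S₁.C.map (algebraMap ℝ ℂ) *ᵥ x₁) := by
    rw [hy₁, Matrix.mulVec_add, hD21, add_zero]
  rw [e1] at hy₁
  rw [Matrix.mulVec_add, e2] at hy₂
  constructor
  · rw [pencil_mulVec, pencil_mulVec, pencil_mulVec, closedLoop_eq h12 h21,
      Matrix.fromBlocks_map, Matrix.fromBlocks_mulVec, loopInput]
    have hr : (Matrix.fromRows (S₁.B * S₂.D) S₂.B).map (algebraMap ℝ ℂ) *ᵥ r =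
        Sum.elim (S₁.B.map (algebraMap ℝ ℂ) *ᵥ (S₂.D.map (algebraMap ℝ ℂ) *ᵥ r))
          (S₂.B.map (algebraMap ℝ ℂ) *ᵥ r) := by
      rw [← map_mul_mulVec]
      ext (i | i) <;> rfl
    have hl (a : Fin n₁ → ℂ) (b : Fin n₂ → ℂ) :
        s • Sum.elim x₁ x₂ - Sum.elim a b = Sum.elim (s • x₁ - a) (s • x₂ - b) := by
      ext (i | i) <;> simp
    rw [hr, hl, Sum.elim_eq_iff]
    simp only [Sum.elim_comp_inl, Sum.elim_comp_inr, map_add_mulVec, map_mul_mulVec]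
    refine and_congr ?_ ?_
    · rw [hy₂]
      simp only [Matrix.mulVec_add, sub_eq_iff_eq_add]
      constructor <;> intro h <;> rw [h] <;> abel
    · rw [hy₁]
      simp only [Matrix.mulVec_add, sub_eq_iff_eq_add]
      constructor <;> intro h <;> rw [h] <;> abel
  · have hr : (loopOutput S₁ S₂).map (algebraMap ℝ ℂ) *ᵥ Sum.elim x₁ x₂ =
        S₂.D.map (algebraMap ℝ ℂ) *ᵥ (S₁.C.map (algebraMap ℝ ℂ) *ᵥ x₁) +
          S₂.C.map (algebraMap ℝ ℂ) *ᵥ x₂ := by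
      rw [← map_mul_mulVec, ← Matrix.fromCols_mulVec_sumElim]
      congr 1
      ext i (j | j) <;> rfl
    rw [hr, hy₂]
    abel

/-- The vanishing products of feedthroughs stop the back-substitution in the algebraic loop after
one round. -/
theorem exists_loop_signals (h12 : S₁.D * S₂.D = 0) (h21 : S₂.D * S₁.D = 0)
    (x₁ : Fin n₁ → ℂ) (x₂ : Fin n₂ → ℂ) (r : Fin m → ℂ) : ∃ y₁ y₂ : Fin m → ℂ,
    y₁ = S₁.C.map (algebraMap ℝ ℂ) *ᵥ x₁ + S₁.D.map (algebraMap ℝ ℂ) *ᵥ y₂ ∧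
    y₂ = S₂.C.map (algebraMap ℝ ℂ) *ᵥ x₂ + S₂.D.map (algebraMap ℝ ℂ) *ᵥ (y₁ + r) := by
  refine ⟨S₁.C.map (algebraMap ℝ ℂ) *ᵥ x₁ +
    S₁.D.map (algebraMap ℝ ℂ) *ᵥ (S₂.C.map (algebraMap ℝ ℂ) *ᵥ x₂),
    S₂.C.map (algebraMap ℝ ℂ) *ᵥ x₂ +
      S₂.D.map (algebraMap ℝ ℂ) *ᵥ (S₁.C.map (algebraMap ℝ ℂ) *ᵥ x₁) +
      S₂.D.map (algebraMap ℝ ℂ) *ᵥ r, ?_, ?_⟩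
  · simp only [Matrix.mulVec_add, ← map_mul_mulVec, h12, ← Matrix.mul_assoc]
    simp
  · simp only [Matrix.mulVec_add, ← map_mul_mulVec, h21, ← Matrix.mul_assoc]
    simp [add_assoc]

/-- An eigenvector of the closed loop with scaled second system yields a nonzero loop signal. -/
theorem IsMinimalRealization.exists_signal_ne_zero {G : TransferMatrix m}
    (hS₁ : S₁.IsMinimalRealization G) (h12 : S₁.D * S₂.D = 0) (h21 : S₂.D * S₁.D = 0) {κ : ℝ}
    {s : ℂ} (hA₂ : (pencil S₂.A s).det ≠ 0)
    (h : (pencil (S₁.closedLoop (S₂.scale κ)) s).det = 0) :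
    ∃ (x : Fin n₁ → ℂ) (y : Fin m → ℂ), ‖y‖ = 1 ∧
      pencil S₁.A s *ᵥ x = S₁.B.map (algebraMap ℝ ℂ) *ᵥ ((κ : ℂ) • (S₂.value s *ᵥ y)) ∧
      y = S₁.C.map (algebraMap ℝ ℂ) *ᵥ x +
        S₁.D.map (algebraMap ℝ ℂ) *ᵥ ((κ : ℂ) • (S₂.value s *ᵥ y)) := by
  suffices h : ∃ (x : Fin n₁ → ℂ) (y : Fin m → ℂ), y ≠ 0 ∧
      pencil S₁.A s *ᵥ x = S₁.B.map (algebraMap ℝ ℂ) *ᵥ ((κ : ℂ) • (S₂.value s *ᵥ y)) ∧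
      y = S₁.C.map (algebraMap ℝ ℂ) *ᵥ x +
        S₁.D.map (algebraMap ℝ ℂ) *ᵥ ((κ : ℂ) • (S₂.value s *ᵥ y)) by
    obtain ⟨x, y, hy, h1, h2⟩ := h
    have hc : (κ : ℂ) • (S₂.value s *ᵥ (((‖y‖⁻¹ : ℝ) : ℂ) • y)) =
        ((‖y‖⁻¹ : ℝ) : ℂ) • ((κ : ℂ) • (S₂.value s *ᵥ y)) := by
      rw [Matrix.mulVec_smul, smul_comm]
    refine ⟨((‖y‖⁻¹ : ℝ) : ℂ) • x, ((‖y‖⁻¹ : ℝ) : ℂ) • y, ?_, ?_, ?_⟩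
    · rw [norm_smul, Complex.norm_real, norm_inv, norm_norm, inv_mul_cancel₀ (norm_ne_zero_iff.2 hy)]
    · rw [hc, Matrix.mulVec_smul, Matrix.mulVec_smul, h1]
    · rw [hc, Matrix.mulVec_smul, Matrix.mulVec_smul, ← smul_add, ← h2]
  obtain ⟨x, hx, hx0⟩ := exists_pencil_mulVec_eq_zero h
  have h12' : S₁.D * (S₂.scale κ).D = 0 := by simp [scale, h12]
  have h21' : (S₂.scale κ).D * S₁.D = 0 := by simp [scale, h21]
  obtain ⟨x₁, x₂, rfl⟩ : ∃ x₁ x₂, x = Sum.elim x₁ x₂ := ⟨_, _, (Sum.elim_comp_inl_inr x).symm⟩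
  obtain ⟨y₁, y₂, hy₁, hy₂⟩ := exists_loop_signals h12' h21' x₁ x₂ 0
  obtain ⟨e1, e2⟩ := (pencil_closedLoop_mulVec_iff h12' h21' hy₁ hy₂).1.1
    (hx0.trans (Matrix.mulVec_zero _).symm)
  rw [add_zero] at hy₂ e2
  change pencil S₂.A s *ᵥ x₂ = S₂.B.map (algebraMap ℝ ℂ) *ᵥ y₁ at e2
  have hv : y₂ = (κ : ℂ) • (S₂.value s *ᵥ y₁) := by
    rw [value, mul_inv_pencil_mulVec S₂.C S₂.D hA₂ e2, hy₂, smul_add, ← Matrix.smul_mulVec,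
      ← Matrix.smul_mulVec]
    congr 2 <;> ext i j <;> simp [scale]
  refine ⟨x₁, y₁, ?_, hv ▸ e1, hv ▸ hy₁⟩
  -- If y₁ = 0 then y₂ = 0, so x₁ is an unobservable solution of the eigenvector equation and x₂
  -- lies in the trivial kernel of sI - A₂. The whole eigenvector would vanish.
  rintro rfl
  rw [Matrix.mulVec_zero, smul_zero] at hv
  subst hv
  rw [Matrix.mulVec_zero] at e1 e2
  rw [Matrix.mulVec_zero, add_zero] at hy₁
  have hx₁ := hS₁.eq_zero_of_unobservable e1 hy₁.symm
  have hx₂ : x₂ = 0 := by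
    rw [← inv_pencil_mulVec_pencil hA₂ x₂, e2,
      Matrix.mulVec_zero]
  apply hx
  rw [hx₁, hx₂]
  ext (i | i) <;> rfl

end StateSpace

/-! ### Symmetry of the values at zero and infinity -/

/-- At u = e_i + √-1 e_j the form has imaginary part M i j - M j i; exchanging i and j gives the
opposite inequality. -/
theorem isSymm_of_im_nonpos {ι : Type*} [Fintype ι] [DecidableEq ι] {M : Matrix ι ι ℝ}
    (h : ∀ u : ι → ℂ, (star u ⬝ᵥ M.map (algebraMap ℝ ℂ) *ᵥ u).im ≤ 0) : M.IsSymm := by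
  have key (i j : ι) : M i j ≤ M j i := by
    have h1 := h (Pi.single i 1 + Pi.single j Complex.I)
    have h2 : star (Pi.single i (1 : ℂ) + Pi.single j Complex.I : ι → ℂ) =
        Pi.single i 1 + Pi.single j (-Complex.I) := by
      rw [star_add, ← Pi.single_star, ← Pi.single_star]
      simp
    rw [h2] at h1
    simp [Matrix.mulVec_add, add_dotProduct, Matrix.mulVec_single] at h1
    linarith
  ext i j
  exact le_antisymm (key j i) (key i j)

theorem isSymm_of_tendsto {ι : Type*} [Fintype ι] [DecidableEq ι] {M : Matrix ι ι ℝ}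
    {F : ℂ → Matrix ι ι ℂ} {l : Filter ℂ} [l.NeBot] (hF : Tendsto F l (𝓝 (M.map (algebraMap ℝ ℂ))))
    (h : ∀ᶠ s in l, (Complex.I • (F s - (F s)ᴴ)).PosSemidef) : M.IsSymm := by
  refine isSymm_of_im_nonpos fun u => ?_
  have hc : Continuous fun N : Matrix ι ι ℂ => (star u ⬝ᵥ N *ᵥ u).im := by fun_prop
  refine le_of_tendsto ((hc.tendsto _).comp hF) ?_
  filter_upwards [h] with s hs
  exact im_star_dotProduct_mulVec_nonpos hs u

theorem StateSpace.not_isPole_transfer {S : StateSpace n m} {s : ℂ}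
    (h : (pencil S.A s).det ≠ 0) : ¬ S.transfer.IsPole s :=
  (not_isPole_iff _ _).2 fun i k => (eval_transfer h i k).1

theorem tendsto_I_mul_cobounded :
    Tendsto (fun w : ℝ => Complex.I * (w : ℂ)) atTop (Bornology.cobounded ℂ) := by
  rw [← tendsto_norm_atTop_iff_cobounded]
  simpa using tendsto_abs_atTop_atTop

theorem tendsto_I_mul_zero :
    Tendsto (fun w : ℝ => Complex.I * (w : ℂ)) (𝓝[>] 0) (𝓝 0) := by
  have : Continuous fun w : ℝ => Complex.I * (w : ℂ) := by fun_prop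
  simpa using (this.tendsto 0).mono_left nhdsWithin_le_nhds

/-- The negative imaginary inequality forces a symmetric value at infinity. -/
theorem StateSpace.isSymm_D (S : StateSpace n m)
    (h : ∀ ω : ℝ, 0 < ω → ¬ S.transfer.IsPole (Complex.I * ω) →
      (Complex.I • (S.transfer.evalAt (Complex.I * ω) -
        (S.transfer.evalAt (Complex.I * ω))ᴴ)).PosSemidef) : S.D.IsSymm := by
  refine isSymm_of_tendsto ((tendsto_transferValue_cobounded S.A S.B S.C S.D).mono_left
    tendsto_I_mul_cobounded) ?_
  rw [eventually_map]
  filter_upwards [eventually_gt_atTop 0, tendsto_I_mul_cobounded.eventually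
    (eventually_det_pencil_ne_zero_cobounded S.A)] with w hw hd
  have := h w hw (not_isPole_transfer hd)
  rwa [evalAt_transfer hd] at this

/-- The negative imaginary inequality forces a symmetric DC gain. -/
theorem StateSpace.isSymm_dcGain (S : StateSpace n m) (h0 : (pencil S.A 0).det ≠ 0)
    (h : ∀ ω : ℝ, 0 < ω → ¬ S.transfer.IsPole (Complex.I * ω) →
      (Complex.I • (S.transfer.evalAt (Complex.I * ω) -
        (S.transfer.evalAt (Complex.I * ω))ᴴ)).PosSemidef) : S.transfer.dcGain.IsSymm := by
  have hc : Tendsto S.value (𝓝 0) (𝓝 (S.transfer.dcGain.map (algebraMap ℝ ℂ))) := by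
    rw [dcGain_map, evalAt_transfer h0]
    exact (continuousAt_transferValue S.A S.B S.C S.D h0).tendsto
  refine isSymm_of_tendsto (hc.mono_left tendsto_I_mul_zero) ?_
  rw [eventually_map]
  filter_upwards [self_mem_nhdsWithin, tendsto_I_mul_zero.eventually
    ((continuous_det_pencil S.A).continuousAt.eventually_ne h0)] with w hw hd
  have := h w hw (not_isPole_transfer hd)
  rwa [evalAt_transfer hd] at this

/-! ### No closed-loop eigenvalues on the imaginary axis -/

namespace StateSpace

variable {S₁ : StateSpace n₁ m} {S₂ : StateSpace n₂ m} {G H : TransferMatrix m}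

theorem IsMinimalRealization.value_eq {S : StateSpace n m} (hS : S.IsMinimalRealization G) {s : ℂ}
    (h : (pencil S.A s).det ≠ 0) : S.value s = G.evalAt s := by
  rw [← hS.1, evalAt_transfer h]

theorem im_star_smul_mulVec_dotProduct {ι : Type*} [Fintype ι] (κ : ℝ) (M : Matrix ι ι ℂ)
    (y : ι → ℂ) : (star ((κ : ℂ) • (M *ᵥ y)) ⬝ᵥ y).im = -κ * (star y ⬝ᵥ M *ᵥ y).im := by
  rw [star_smul, smul_dotProduct, Matrix.star_dotProduct]
  simp

/-- An eigenvector yields y ≠ 0 such that G responds to u = κHy with y. Dissipation of G gives Im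
u*y ≤ 0, whereas Im u*y = -κ Im y*Hy > 0. -/
theorem det_pencil_closedLoop_ne_zero_of_pos (hS₁ : S₁.IsMinimalRealization G)
    (hS₂ : S₂.IsMinimalRealization H) (hG : G.IsNegativeImaginary)
    (hH : H.IsStrictlyNegativeImaginary) (h12 : S₁.D * S₂.D = 0) (h21 : S₂.D * S₁.D = 0)
    {κ ω : ℝ} (hκ : 0 < κ) (hω : 0 < ω) :
    (pencil (S₁.closedLoop (S₂.scale κ)) (Complex.I * ω)).det ≠ 0 := by
  intro h
  have hA₂ := hS₂.det_pencil_ne_zero (hH.no_pole (Complex.I * ω) (by simp))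
  obtain ⟨x, y, hy, h1, h2⟩ := hS₁.exists_signal_ne_zero h12 h21 hA₂ h
  have hy0 : y ≠ 0 := fun h => by simp [h] at hy
  have h3 := hS₁.im_star_dotProduct_output_nonpos hG hω h1
  rw [← h2, im_star_smul_mulVec_dotProduct, hS₂.value_eq hA₂] at h3
  have h4 := im_star_dotProduct_mulVec_neg (hH.freq_pos ω hω) hy0
  nlinarith

/-- Negative frequencies follow by conjugation. At s = 0 both systems are regular, and the loop
equation becomes the one that `h0` excludes. -/
theorem det_pencil_closedLoop_ne_zero_of_re_eq_zero (hS₁ : S₁.IsMinimalRealization G)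
    (hS₂ : S₂.IsMinimalRealization H) (hG : G.IsNegativeImaginary)
    (hH : H.IsStrictlyNegativeImaginary) (h12 : S₁.D * S₂.D = 0) (h21 : S₂.D * S₁.D = 0)
    {κ : ℝ} (hκ : 0 < κ)
    (h0 : ∀ y : Fin m → ℂ, (κ : ℂ) • (G.evalAt 0 *ᵥ (H.evalAt 0 *ᵥ y)) = y → y = 0)
    {s : ℂ} (hs : s.re = 0) : (pencil (S₁.closedLoop (S₂.scale κ)) s).det ≠ 0 := by
  obtain ⟨ω, rfl⟩ : ∃ ω : ℝ, s = Complex.I * ω := ⟨s.im, Complex.ext (by simp [hs]) (by simp)⟩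
  rcases lt_trichotomy ω 0 with hω | rfl | hω
  · have h1 := det_pencil_closedLoop_ne_zero_of_pos hS₁ hS₂ hG hH h12 h21 hκ (neg_pos.2 hω)
    have h2 : Complex.I * ω = starRingEnd ℂ (Complex.I * (-ω : ℝ)) := by simp
    rw [h2, det_pencil_conj]
    simpa using h1
  · simp only [Complex.ofReal_zero, mul_zero]
    intro h
    have hA₁ := hS₁.det_pencil_ne_zero hG.no_pole_zero
    have hA₂ := hS₂.det_pencil_ne_zero (hH.no_pole 0 (by simp))
    obtain ⟨x, y, hy, h1, h2⟩ := hS₁.exists_signal_ne_zero h12 h21 hA₂ h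
    rw [← mul_inv_pencil_mulVec S₁.C S₁.D hA₁ h1, Matrix.mulVec_smul] at h2
    have h3 : S₁.value 0 = G.evalAt 0 := hS₁.value_eq hA₁
    rw [value] at h3
    rw [h3, hS₂.value_eq hA₂] at h2
    simp [h0 y h2.symm] at hy
  · exact det_pencil_closedLoop_ne_zero_of_pos hS₁ hS₂ hG hH h12 h21 hκ hω

theorem continuous_closedLoop_scale (h12 : S₁.D * S₂.D = 0) (h21 : S₂.D * S₁.D = 0) :
    Continuous fun κ => S₁.closedLoop (S₂.scale κ) := by
  have h (κ : ℝ) : S₁.closedLoop (S₂.scale κ) = Matrix.fromBlocks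
      (S₁.A + S₁.B * (κ • S₂.D) * S₁.C) (S₁.B * (κ • S₂.C))
      (S₂.B * S₁.C) (S₂.A + S₂.B * S₁.D * (κ • S₂.C)) :=
    closedLoop_eq (by simp [scale, h12]) (by simp [scale, h21])
  simp_rw [h]
  refine Continuous.matrix_fromBlocks ?_ ?_ ?_ ?_ <;> fun_prop

theorem det_pencil_closedLoop_scale_zero (S₁ : StateSpace n₁ m) (S₂ : StateSpace n₂ m) (s : ℂ) :
    (pencil (S₁.closedLoop (S₂.scale 0)) s).det = (pencil S₁.A s).det * (pencil S₂.A s).det := by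
  have h : S₁.closedLoop (S₂.scale 0) = Matrix.fromBlocks S₁.A 0 (S₂.B * S₁.C) S₂.A := by
    rw [closedLoop_eq (by simp [scale]) (by simp [scale])]
    simp [scale]
  rw [det_pencil, h, Matrix.charpoly_fromBlocks_zero₁₂, map_mul, det_pencil, det_pencil]

end StateSpace

/-! ### Stability for small gain -/

/-- Near an imaginary-axis pole, in the open right half-plane, the singular part of a negative
imaginary transfer function matrix has nonpositive imaginary part. -/
theorem im_star_dotProduct_singular_nonpos {R : Matrix (Fin m) (Fin m) ℂ} {ω : ℝ} (hω : 0 < ω)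
    (hR : ((Complex.I * ω) • R).PosSemidef) {s : ℂ} (hs : 0 < s.re) (u : Fin m → ℂ) :
    (star u ⬝ᵥ ((s - Complex.I * ω)⁻¹ • R) *ᵥ u).im ≤ 0 := by
  have h := hR.dotProduct_mulVec_nonneg u
  rw [Matrix.smul_mulVec, dotProduct_smul, smul_eq_mul] at h
  rw [Matrix.smul_mulVec, dotProduct_smul, smul_eq_mul]
  set q := star u ⬝ᵥ R *ᵥ u
  obtain ⟨h1, h2⟩ := Complex.le_def.1 h
  simp at h1 h2
  -- jωq ≥ 0 makes q a nonpositive multiple of the imaginary unit, and Re (s - jω)⁻¹ ≥ 0.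
  have hre : q.re = 0 := h2.resolve_left hω.ne'
  have him : q.im ≤ 0 := by nlinarith
  rw [Complex.mul_im, hre, mul_zero, add_zero, Complex.inv_re]
  refine mul_nonpos_of_nonneg_of_nonpos (div_nonneg ?_ (Complex.normSq_nonneg _)) him
  simpa using hs.le

/-- The loop equation gives -Im y*Hy = κ Im (Hy)*G(Hy), and the singular part of G contributes at
most 0. What remains is κ times a quantity that stays bounded as s → jω, so it vanishes as κ → 0. -/
theorem neg_im_le_of_loop {R Gs Hs : Matrix (Fin m) (Fin m) ℂ} {ω : ℝ} (hω : 0 < ω)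
    (hR : ((Complex.I * ω) • R).PosSemidef) {s : ℂ} (hs : 0 < s.re) {κ : ℝ} (hκ : 0 < κ)
    {y : Fin m → ℂ} (hy : y = Gs *ᵥ ((κ : ℂ) • (Hs *ᵥ y))) :
    -(star y ⬝ᵥ Hs *ᵥ y).im ≤
      κ * (star (Hs *ᵥ y) ⬝ᵥ (Gs - (s - Complex.I * ω)⁻¹ • R) *ᵥ (Hs *ᵥ y)).im := by
  have h1 : star (Hs *ᵥ y) ⬝ᵥ y = star (star y ⬝ᵥ Hs *ᵥ y) := Matrix.star_dotProduct _ _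
  have h2 : (star (Hs *ᵥ y) ⬝ᵥ y).im = κ * (star (Hs *ᵥ y) ⬝ᵥ Gs *ᵥ (Hs *ᵥ y)).im := by
    have h : star (Hs *ᵥ y) ⬝ᵥ y = κ * (star (Hs *ᵥ y) ⬝ᵥ Gs *ᵥ (Hs *ᵥ y)) := by
      rw [← smul_eq_mul, ← dotProduct_smul, ← Matrix.mulVec_smul, ← hy]
    rw [h, Complex.im_ofReal_mul]
  have h3 := im_star_dotProduct_singular_nonpos hω hR hs (Hs *ᵥ y)
  rw [h1] at h2
  rw [Matrix.sub_mulVec, dotProduct_sub, Complex.sub_im]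
  have h4 : (star (star y ⬝ᵥ Hs *ᵥ y)).im = -(star y ⬝ᵥ Hs *ᵥ y).im := Complex.conj_im _
  rw [h4] at h2
  nlinarith

theorem tendsto_mulVec {ι α : Type*} [Fintype ι] {l : Filter α}
    {M : α → Matrix ι ι ℂ} {M₀ : Matrix ι ι ℂ} {v : α → ι → ℂ} {v₀ : ι → ℂ}
    (hM : Tendsto M l (𝓝 M₀)) (hv : Tendsto v l (𝓝 v₀)) :
    Tendsto (fun k => M k *ᵥ v k) l (𝓝 (M₀ *ᵥ v₀)) :=
  tendsto_pi_nhds.2 fun i => tendsto_finsetSum _ fun j _ =>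
    (tendsto_pi_nhds.1 (tendsto_pi_nhds.1 hM i) j).mul (tendsto_pi_nhds.1 hv j)

theorem tendsto_im_star_dotProduct {ι α : Type*} [Fintype ι] {l : Filter α}
    {M : α → Matrix ι ι ℂ} {M₀ : Matrix ι ι ℂ} {v : α → ι → ℂ} {v₀ : ι → ℂ}
    (hM : Tendsto M l (𝓝 M₀)) (hv : Tendsto v l (𝓝 v₀)) :
    Tendsto (fun k => (star (v k) ⬝ᵥ M k *ᵥ v k).im) l (𝓝 (star v₀ ⬝ᵥ M₀ *ᵥ v₀).im) := by
  refine (Complex.continuous_im.tendsto _).comp ?_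
  exact tendsto_finsetSum _ fun j _ => ((continuous_star.tendsto _).comp
    (tendsto_pi_nhds.1 hv j)).mul (tendsto_pi_nhds.1 (tendsto_mulVec hM hv) j)

namespace StateSpace

variable {S₁ : StateSpace n₁ m} {S₂ : StateSpace n₂ m} {G H : TransferMatrix m}

theorem exists_det_pencil_im_nonneg {ι : Type*} [Fintype ι] [DecidableEq ι] {A : Matrix ι ι ℝ}
    {s : ℂ} (hs : 0 ≤ s.re) (h : (pencil A s).det = 0) :
    ∃ z : ℂ, 0 ≤ z.re ∧ 0 ≤ z.im ∧ (pencil A z).det = 0 := by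
  rcases le_total 0 s.im with hi | hi
  · exact ⟨s, hs, hi, h⟩
  · exact ⟨starRingEnd ℂ s, by simpa using hs, by simpa using hi, by
      rw [det_pencil_conj, h, map_zero]⟩

/-- The interconnection of a negative imaginary system with a strictly negative imaginary one of
sufficiently small gain is stable. -/
theorem exists_isHurwitz_closedLoop_scale (hS₁ : S₁.IsMinimalRealization G)
    (hS₂ : S₂.IsMinimalRealization H) (hG : G.IsNegativeImaginary)
    (hH : H.IsStrictlyNegativeImaginary) (h12 : S₁.D * S₂.D = 0) (h21 : S₂.D * S₁.D = 0)
    (hax : ∀ κ : ℝ, 0 < κ → κ ≤ 1 → ∀ s : ℂ, s.re = 0 →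
      (pencil (S₁.closedLoop (S₂.scale κ)) s).det ≠ 0) :
    ∃ κ : ℝ, 0 < κ ∧ κ ≤ 1 ∧ IsHurwitz (S₁.closedLoop (S₂.scale κ)) := by
  by_contra! hcon
  -- Instability at every gain 1/(k + 1) supplies unstable eigenvalues s k and unit signals y k. The
  -- eigenvalues are uniformly bounded, so a subsequence converges.
  let κ : ℕ → ℝ := fun k => 1 / ((k : ℝ) + 1)
  have hκ0 (k) : 0 < κ k := by positivity
  have hκ1 (k) : κ k ≤ 1 := by
    rw [div_le_one (by positivity)]
    linarith [Nat.cast_nonneg (α := ℝ) k]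
  have hA₂ {s : ℂ} (hs : 0 ≤ s.re) := hS₂.det_pencil_ne_zero (hH.no_pole s hs)
  have hex (k : ℕ) : ∃ (s : ℂ) (x : Fin n₁ → ℂ) (y : Fin m → ℂ), 0 < s.re ∧ 0 ≤ s.im ∧
      (pencil (S₁.closedLoop (S₂.scale (κ k))) s).det = 0 ∧ ‖y‖ = 1 ∧
      pencil S₁.A s *ᵥ x = S₁.B.map (algebraMap ℝ ℂ) *ᵥ ((κ k : ℂ) • (S₂.value s *ᵥ y)) ∧
      y = S₁.C.map (algebraMap ℝ ℂ) *ᵥ x +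
        S₁.D.map (algebraMap ℝ ℂ) *ᵥ ((κ k : ℂ) • (S₂.value s *ᵥ y)) := by
    have := hcon (κ k) (hκ0 k) (hκ1 k)
    rw [isHurwitz_iff] at this
    push Not at this
    obtain ⟨s', hs', h0'⟩ := this
    obtain ⟨s, hs, hi, h0⟩ := exists_det_pencil_im_nonneg hs' h0'
    obtain ⟨x, y, hy, h1, h2⟩ := hS₁.exists_signal_ne_zero h12 h21 (hA₂ hs) h0
    exact ⟨s, x, y, lt_of_le_of_ne hs fun h => hax (κ k) (hκ0 k) (hκ1 k) s h.symm h0, hi, h0,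
      hy, h1, h2⟩
  choose s x y hsre hsim hdet hy hx hxy using hex
  have hM := continuous_closedLoop_scale (S₁ := S₁) (S₂ := S₂) h12 h21
  have hsum : Continuous fun κ => ∑ i, ∑ j, |S₁.closedLoop (S₂.scale κ) i j| := by fun_prop
  obtain ⟨B, hB⟩ := (isCompact_Icc (a := (0 : ℝ)) (b := 1)).bddAbove_image hsum.continuousOn
  have hmem (k) : (s k, y k) ∈ Metric.closedBall (0 : ℂ) B ×ˢ Metric.sphere (0 : Fin m → ℂ) 1 := by
    refine ⟨?_, by simpa using hy k⟩
    rw [mem_closedBall_zero_iff]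
    exact (norm_le_sum_of_det_pencil_eq_zero (hdet k)).trans
      (hB ⟨κ k, ⟨(hκ0 k).le, hκ1 k⟩, rfl⟩)
  obtain ⟨⟨s₀, y₀⟩, hmem₀, φ, hφ, hlim⟩ :=
    ((isCompact_closedBall (0 : ℂ) B).prod (isCompact_sphere (0 : Fin m → ℂ) 1)).tendsto_subseq hmem
  have hs : Tendsto (fun k => s (φ k)) atTop (𝓝 s₀) := (continuous_fst.tendsto _).comp hlim
  have hyl : Tendsto (fun k => y (φ k)) atTop (𝓝 y₀) := (continuous_snd.tendsto _).comp hlim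
  have hκ : Tendsto (fun k => κ (φ k)) atTop (𝓝 0) :=
    tendsto_one_div_add_atTop_nhds_zero_nat.comp hφ.tendsto_atTop
  have hre0 : 0 ≤ s₀.re := ge_of_tendsto' ((Complex.continuous_re.tendsto _).comp hs)
    fun k => (hsre _).le
  have him0 : 0 ≤ s₀.im := ge_of_tendsto' ((Complex.continuous_im.tendsto _).comp hs)
    fun k => hsim _
  have hd0 : (pencil (S₁.closedLoop (S₂.scale 0)) s₀).det = 0 := by
    have h1 := ((continuous_det_pencil_uncurry hM).tendsto (0, s₀)).comp (hκ.prodMk_nhds hs)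
    exact tendsto_nhds_unique h1 (tendsto_const_nhds.congr fun k => (hdet (φ k)).symm)
  -- s₀ is an eigenvalue of the decoupled loop at κ = 0, and A₂ has none with Re ≥ 0.
  have hpole : G.IsPole s₀ := by
    by_contra hp
    rw [det_pencil_closedLoop_scale_zero] at hd0
    exact mul_ne_zero (hS₁.det_pencil_ne_zero hp) (hA₂ hre0) hd0
  -- G has no pole at 0 or in the open right half-plane; taking Im (s k) ≥ 0, possible by
  -- conjugation, makes ω positive.
  obtain ⟨ω, hω, rfl⟩ : ∃ ω : ℝ, 0 < ω ∧ s₀ = Complex.I * ω := by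
    have hr : s₀.re = 0 := by
      by_contra h
      exact hG.no_pole_right s₀ (lt_of_le_of_ne hre0 (Ne.symm h)) hpole
    refine ⟨s₀.im, lt_of_le_of_ne him0 fun h => hG.no_pole_zero ?_,
      Complex.ext (by simp [hr]) (by simp)⟩
    rwa [show s₀ = 0 from Complex.ext hr h.symm] at hpole
  obtain ⟨R, b, hb, hR⟩ := hG.exists_residue hω
  have hs' : Tendsto (fun k => s (φ k)) atTop (𝓝[≠] (Complex.I * ω)) := by
    refine tendsto_nhdsWithin_of_tendsto_nhds_of_eventually_within _ hs
      (Eventually.of_forall fun k h => ?_)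
    have := hsre (φ k)
    rw [show s (φ k) = Complex.I * ω from h] at this
    simp at this
  have hHl : Tendsto (fun k => S₂.value (s (φ k))) atTop (𝓝 (S₂.value (Complex.I * ω))) :=
    (continuousAt_transferValue S₂.A S₂.B S₂.C S₂.D (hA₂ hre0)).tendsto.comp hs
  have hleft := (tendsto_im_star_dotProduct hHl hyl).neg
  have hright := hκ.mul (tendsto_im_star_dotProduct (hb.comp hs') (tendsto_mulVec hHl hyl))
  rw [zero_mul] at hright
  have hle := le_of_tendsto_of_tendsto' hleft hright fun k => by
    have hA₁ := hS₁.det_pencil_ne_zero (hG.no_pole_right _ (hsre (φ k)))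
    have h1 := mul_inv_pencil_mulVec S₁.C S₁.D hA₁ (hx (φ k))
    rw [← hxy (φ k)] at h1
    have h2 : S₁.value (s (φ k)) = G.evalAt (s (φ k)) := hS₁.value_eq hA₁
    rw [value] at h2
    rw [h2] at h1
    exact neg_im_le_of_loop hω hR (hsre (φ k)) (hκ0 (φ k)) h1.symm
  have hneg := im_star_dotProduct_mulVec_neg (hH.freq_pos ω hω) (u := y₀) (by
    rintro rfl
    have := hmem₀.2
    simp at this)
  rw [hS₂.value_eq (hA₂ hre0)] at hle
  linarith

end StateSpace

/-! ### Existence of minimal realizations -/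

/-- The companion matrix of a polynomial, acting on the powers of a variable. -/
def companionMatrix (d : ℝ[X]) : Matrix (Fin d.natDegree) (Fin d.natDegree) ℝ :=
  Matrix.of fun l j => if (j : ℕ) = l + 1 then 1 else if (l : ℕ) + 1 = d.natDegree then -d.coeff j
    else 0

/-- The vector of powers of X is an eigenvector for X up to the defect d in the last row. That
defect is what the input matrix of the realization matches. -/
theorem sum_companionMatrix_mul_pow {d : ℝ[X]} (hd : d.Monic) (l : Fin d.natDegree) :
    ∑ j, Polynomial.C (companionMatrix d l j) * X ^ (j : ℕ) =
      X ^ ((l : ℕ) + 1) - if (l : ℕ) + 1 = d.natDegree then d else 0 := by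
  split_ifs with h
  · have h1 (j : Fin d.natDegree) : companionMatrix d l j = -d.coeff j := by
      have := j.2
      rw [companionMatrix, Matrix.of_apply, if_neg (by omega), if_pos h]
    simp_rw [h1, C_neg, neg_mul, Finset.sum_neg_distrib]
    rw [Fin.sum_univ_eq_sum_range (fun j => Polynomial.C (d.coeff j) * X ^ j)]
    have h2 := hd.as_sum
    rw [h]
    nth_rewrite 4 [h2]
    ring
  · have hl := l.2
    rw [sub_zero, Finset.sum_eq_single (⟨l + 1, by omega⟩ : Fin d.natDegree)]
    · simp [companionMatrix]
    · intro j _ hj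
      have : (j : ℕ) ≠ l + 1 := fun h => hj (Fin.ext h)
      simp [companionMatrix, this, h]
    · simp

theorem exists_stateSpace_of_fintype {ι : Type*} [Fintype ι] [DecidableEq ι] (A : Matrix ι ι ℝ)
    (B : Matrix ι (Fin m) ℝ) (C : Matrix (Fin m) ι ℝ) (D : Matrix (Fin m) (Fin m) ℝ) :
    ∃ (n : ℕ) (S : StateSpace n m), S.transfer = C.map (algebraMap ℝ (RatFunc ℝ)) *
      (ratPencil A)⁻¹ * B.map (algebraMap ℝ (RatFunc ℝ)) + D.map (algebraMap ℝ (RatFunc ℝ)) := by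
  let e := Fintype.equivFin ι
  refine ⟨_, ⟨A.submatrix e.symm e.symm, B.submatrix e.symm id, C.submatrix id e.symm, D⟩, ?_⟩
  have h : ratPencil (A.submatrix e.symm e.symm) = (ratPencil A).submatrix e.symm e.symm := by
    ext i j
    simp [ratPencil, Matrix.one_apply]
  rw [StateSpace.transfer_eq]
  simp only [h, Matrix.inv_submatrix_equiv, ← Matrix.submatrix_map, Matrix.submatrix_mul_equiv,
    Matrix.submatrix_id_id]

/-- A strictly proper matrix with a common denominator, plus a constant, is realizable. -/
theorem exists_stateSpace_of_common_denom {d : ℝ[X]} (hd : d.Monic)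
    (p : Matrix (Fin m) (Fin m) ℝ[X]) (hp : ∀ i k, (p i k).degree < d.degree)
    (D : Matrix (Fin m) (Fin m) ℝ) :
    ∃ (n : ℕ) (S : StateSpace n m), ∀ i k, S.transfer i k =
      algebraMap ℝ[X] (RatFunc ℝ) (p i k) / algebraMap ℝ[X] (RatFunc ℝ) d +
        algebraMap ℝ (RatFunc ℝ) (D i k) := by
  let A : Matrix (Fin m × Fin d.natDegree) (Fin m × Fin d.natDegree) ℝ :=
    Matrix.of fun a b => if a.1 = b.1 then companionMatrix d a.2 b.2 else 0
  let B : Matrix (Fin m × Fin d.natDegree) (Fin m) ℝ :=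
    Matrix.of fun a k => if a.1 = k then (if (a.2 : ℕ) + 1 = d.natDegree then 1 else 0) else 0
  let C : Matrix (Fin m) (Fin m × Fin d.natDegree) ℝ := Matrix.of fun i a => (p i a.1).coeff a.2
  obtain ⟨n, S, hS⟩ := exists_stateSpace_of_fintype A B C D
  refine ⟨n, S, fun i k => ?_⟩
  let φ := algebraMap ℝ[X] (RatFunc ℝ)
  have hC (a : ℝ) : algebraMap ℝ (RatFunc ℝ) a = φ (Polynomial.C a) := rfl
  have hφd : φ d ≠ 0 := by simpa [φ] using hd.ne_zero
  -- The explicit solution of (sI - A)Z = B: block k of column k is (1, s, s², …)/d. The rows of C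
  -- then assemble the numerators from their coefficients.
  let Z : Matrix (Fin m × Fin d.natDegree) (Fin m) (RatFunc ℝ) :=
    Matrix.of fun a k => if a.1 = k then φ (X ^ (a.2 : ℕ)) / φ d else 0
  have hZ : ratPencil A * Z = B.map (algebraMap ℝ (RatFunc ℝ)) := by
    rw [ratPencil, Matrix.sub_mul, Matrix.smul_mul, Matrix.one_mul]
    ext ⟨k₁, l⟩ k₂
    rw [Matrix.sub_apply, Matrix.smul_apply, Matrix.mul_apply, Fintype.sum_prod_type]
    have hsum := congrArg φ (sum_companionMatrix_mul_pow hd l)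
    by_cases hk : k₁ = k₂
    · subst hk
      rw [Finset.sum_eq_single k₁ (fun b _ hb => by simp [A, Ne.symm hb]) (by simp)]
      simp only [A, B, Z, Matrix.map_apply, Matrix.of_apply, if_true, hC, ← mul_div_assoc,
        ← Finset.sum_div, ← map_mul, ← map_sum]
      rw [hsum, map_sub, smul_eq_mul, ← RatFunc.algebraMap_X, ← mul_div_assoc, ← map_mul, ← pow_succ',
        ← sub_div, sub_sub_cancel]
      split_ifs with h
      · rw [div_self hφd]; simp
      · simp
    · simp [A, B, Z, hk]
  have hZ' : (ratPencil A)⁻¹ * B.map (algebraMap ℝ (RatFunc ℝ)) = Z := by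
    rw [← hZ, Matrix.nonsing_inv_mul_cancel_left _ _ (isUnit_det_ratPencil A)]
  rw [hS, Matrix.mul_assoc, hZ', Matrix.add_apply, Matrix.map_apply, Matrix.mul_apply,
    Fintype.sum_prod_type, Finset.sum_eq_single k (fun b _ hb => by simp [Z, hb]) (by simp)]
  simp only [C, Z, Matrix.map_apply, Matrix.of_apply, if_true, hC, ← mul_div_assoc,
    ← Finset.sum_div, ← map_mul, ← map_sum]
  congr 3
  rw [Fin.sum_univ_eq_sum_range (fun j => Polynomial.C ((p i k).coeff j) * X ^ j)]
  by_cases h0 : p i k = 0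
  · simp [h0]
  · exact (as_sum_range_C_mul_X_pow' (p i k) (natDegree_lt_natDegree h0 (hp i k))).symm

theorem exists_realization {G : TransferMatrix m} (hG : G.IsProper) :
    ∃ (n : ℕ) (S : StateSpace n m), S.transfer = G := by
  obtain ⟨d, hd, hdvd⟩ : ∃ d : ℝ[X], d.Monic ∧ ∀ i k, (G i k).denom ∣ d :=
    ⟨∏ i, ∏ k, (G i k).denom,
      monic_prod_of_monic _ _ fun i _ => monic_prod_of_monic _ _ fun k _ => RatFunc.monic_denom _,
      fun i k => (Finset.dvd_prod_of_mem (fun k => (G i k).denom) (Finset.mem_univ k)).trans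
        (Finset.dvd_prod_of_mem (fun i => ∏ k, (G i k).denom) (Finset.mem_univ i))⟩
  choose q hq using hdvd
  -- Reduced denominators are monic, so the value at infinity needs no division.
  let D : Matrix (Fin m) (Fin m) ℝ := Matrix.of fun i k => (G i k).num.coeff (G i k).denom.natDegree
  let r : Fin m → Fin m → ℝ[X] := fun i k => (G i k).num - Polynomial.C (D i k) * (G i k).denom
  have hr (i k) : (r i k).degree < (G i k).denom.degree := by
    have hm := RatFunc.monic_denom (G i k)
    rw [degree_eq_natDegree hm.ne_zero, degree_lt_iff_coeff_zero]
    intro j hj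
    rcases hj.eq_or_lt with rfl | hj
    · simp [r, D, hm.coeff_natDegree]
    · simp only [r, coeff_sub, coeff_C_mul]
      rw [coeff_eq_zero_of_natDegree_lt ((hG i k).trans_lt hj), coeff_eq_zero_of_natDegree_lt hj]
      simp
  obtain ⟨n, S, hS⟩ := exists_stateSpace_of_common_denom hd (Matrix.of fun i k => r i k * q i k)
    (fun i k => by
      have hq0 : q i k ≠ 0 := fun h => hd.ne_zero (by rw [hq i k, h, mul_zero])
      rw [Matrix.of_apply, hq i k, degree_mul, degree_mul]
      exact WithBot.add_lt_add_right (degree_ne_bot.2 hq0) (hr i k)) D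
  refine ⟨n, S, Matrix.ext fun i k => ?_⟩
  have hq0 : q i k ≠ 0 := fun h => hd.ne_zero (by rw [hq i k, h, mul_zero])
  have h1 : algebraMap ℝ[X] (RatFunc ℝ) (q i k) ≠ 0 := by simpa using hq0
  have h2 : algebraMap ℝ[X] (RatFunc ℝ) (G i k).denom ≠ 0 := by simpa using (G i k).denom_ne_zero
  have h3 : algebraMap ℝ (RatFunc ℝ) (D i k) =
    algebraMap ℝ[X] (RatFunc ℝ) (Polynomial.C (D i k)) := rfl
  rw [hS, Matrix.of_apply, hq i k, map_mul, map_mul, mul_div_mul_right _ _ h1, h3]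
  conv_rhs => rw [← RatFunc.num_div_denom (G i k)]
  rw [div_add' _ _ _ h2, ← map_mul, ← map_add]
  simp [r]

theorem exists_isMinimalRealization {G : TransferMatrix m} (hG : G.IsProper) :
    ∃ (n : ℕ) (S : StateSpace n m), S.IsMinimalRealization G := by
  classical
  have h := exists_realization hG
  obtain ⟨S, hS⟩ := Nat.find_spec h
  exact ⟨_, S, hS, fun n' S' hS' => Nat.find_min' h ⟨S', hS'⟩⟩

/-! ### The spectrum of the DC loop gain -/

theorem star_comp_algebraMap {ι : Type*} (u : ι → ℝ) :
    star (algebraMap ℝ ℂ ∘ u) = algebraMap ℝ ℂ ∘ u := by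
  ext i
  simp

theorem comp_dotProduct_comp {ι : Type*} [Fintype ι] (u v : ι → ℝ) :
    (algebraMap ℝ ℂ ∘ u) ⬝ᵥ (algebraMap ℝ ℂ ∘ v) = ((u ⬝ᵥ v : ℝ) : ℂ) := by
  simp [dotProduct]

open scoped MatrixOrder in
theorem posSemidef_map {ι : Type*} [Fintype ι] [DecidableEq ι] {M : Matrix ι ι ℝ}
    (h : M.PosSemidef) : (M.map (algebraMap ℝ ℂ)).PosSemidef := by
  obtain ⟨B, rfl⟩ := CStarAlgebra.nonneg_iff_eq_star_mul_self.1 h.nonneg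
  rw [Matrix.map_mul, Matrix.star_eq_conjTranspose, Matrix.conjTranspose_map]
  · exact Matrix.posSemidef_conjTranspose_mul_self _
  · intro x
    simp

/-- The spectrum of a product of a symmetric and a positive semidefinite real matrix is real. -/
theorem im_eq_zero_of_mem_complexSpectrum_mul {P Q : Matrix (Fin m) (Fin m) ℝ} (hP : P.IsSymm)
    (hQ : Q.PosSemidef) {μ : ℂ} (hμ : μ ∈ complexSpectrum (P * Q)) : μ.im = 0 := by
  rw [mem_complexSpectrum_iff] at hμ
  obtain ⟨v, hv, hv0⟩ := exists_pencil_mulVec_eq_zero hμ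
  rw [pencil_mulVec, sub_eq_zero, map_mul_mulVec] at hv0
  have hQ' := posSemidef_map hQ
  set Q' := Q.map (algebraMap ℝ ℂ)
  set P' := P.map (algebraMap ℝ ℂ) with hP'
  have hPh : P'.IsHermitian := by
    ext i j
    have := congrFun (congrFun hP i) j
    simp only [Matrix.transpose_apply] at this
    simp [P', this]
  -- Both quadratic forms are real, so μ is real unless v*Qv = 0. In that case Qv = 0, hence μv = 0
  -- and μ = 0.
  have h1 : star (Q' *ᵥ v) ⬝ᵥ P' *ᵥ (Q' *ᵥ v) = μ * (star v ⬝ᵥ Q' *ᵥ v) := by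
    rw [← hv0, Matrix.star_mulVec, hQ'.1.eq, dotProduct_smul, ← Matrix.dotProduct_mulVec,
      smul_eq_mul]
  have h2 : (star (Q' *ᵥ v) ⬝ᵥ P' *ᵥ (Q' *ᵥ v)).im = 0 := by
    have h3 : star (star (Q' *ᵥ v) ⬝ᵥ P' *ᵥ (Q' *ᵥ v)) = star (Q' *ᵥ v) ⬝ᵥ P' *ᵥ (Q' *ᵥ v) := by
      rw [← Matrix.star_dotProduct, Matrix.star_mulVec P', hPh.eq, ← Matrix.dotProduct_mulVec]
    exact Complex.conj_eq_iff_im.1 h3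
  obtain ⟨h4, h5⟩ := Complex.le_def.1 (hQ'.dotProduct_mulVec_nonneg v)
  simp only [Complex.zero_re, Complex.zero_im] at h4 h5
  rw [h1, Complex.mul_im, ← h5, mul_zero, zero_add] at h2
  rcases mul_eq_zero.1 h2 with h | h
  · exact h
  · have h6 : star v ⬝ᵥ Q' *ᵥ v = 0 := Complex.ext h h5.symm
    have h7 : Q' *ᵥ v = 0 := (hQ'.dotProduct_mulVec_zero_iff v).1 h6
    rw [h7, Matrix.mulVec_zero] at hv0
    rw [(smul_eq_zero.1 hv0).resolve_right hv, Complex.zero_im]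

theorem mem_spectrum_real_iff (M : Matrix (Fin m) (Fin m) ℝ) (x : ℝ) :
    x ∈ spectrum ℝ M ↔ (pencil M x).det = 0 := by
  rw [Matrix.mem_spectrum_iff_isRoot_charpoly, det_pencil, IsRoot]
  have := Polynomial.aeval_algebraMap_apply_eq_algebraMap_eval (A := ℂ) x M.charpoly
  simp only [Complex.coe_algebraMap] at this
  rw [this, Complex.ofReal_eq_zero]

theorem finite_spectrum_real (M : Matrix (Fin m) (Fin m) ℝ) : (spectrum ℝ M).Finite := by
  refine M.charpoly.roots.toFinset.finite_toSet.subset fun x hx => ?_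
  rw [Matrix.mem_spectrum_iff_isRoot_charpoly] at hx
  simpa [M.charpoly_monic.ne_zero] using hx

theorem lambdaMax_lt_one_iff (M : Matrix (Fin m) (Fin m) ℝ) :
    lambdaMax M < 1 ↔ ∀ x ∈ spectrum ℝ M, x < 1 := by
  have hfin := finite_spectrum_real M
  constructor
  · exact fun h x hx => (le_csSup hfin.bddAbove hx).trans_lt h
  · intro h
    rcases (spectrum ℝ M).eq_empty_or_nonempty with he | hne
    -- The supremum of the empty set is 0, which is below 1.
    · simp [lambdaMax, he]
    · exact h _ (hne.csSup_mem hfin)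

/-! ### Stability of the loop and the eigenvalues of G(0)H(0) -/

namespace StateSpace

variable {S₁ : StateSpace n₁ m} {S₂ : StateSpace n₂ m} {G H : TransferMatrix m}

/-- The DC gain of a strictly negative imaginary system dominates its value at infinity. -/
theorem IsMinimalRealization.dotProduct_D_le_dcGain (hS₂ : S₂.IsMinimalRealization H)
    (hH : H.IsStrictlyNegativeImaginary) (u : Fin m → ℝ) :
    u ⬝ᵥ S₂.D *ᵥ u ≤ u ⬝ᵥ H.dcGain *ᵥ u := by
  have hA {s : ℂ} (hs : 0 ≤ s.re) := hS₂.det_pencil_ne_zero (hH.no_pole s hs)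
  have h := dotProduct_le_re_transferForm_zero S₂.B S₂.C S₂.D u (fun s hs => hA hs)
    fun ω hω => by
      have h1 : S₂.value (Complex.I * ω) = H.evalAt (Complex.I * ω) :=
        hS₂.value_eq (hA (by simp))
      rw [value] at h1
      have h2 := im_star_dotProduct_mulVec_nonpos (hH.freq_pos ω hω).posSemidef
        (algebraMap ℝ ℂ ∘ u)
      rwa [star_comp_algebraMap, ← h1] at h2
  have h0 : S₂.value 0 = H.evalAt 0 := hS₂.value_eq (hA le_rfl)
  rw [value] at h0
  rwa [transferForm, h0, ← dcGain_map, ← map_mulVec_comp, comp_dotProduct_comp,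
    Complex.ofReal_re] at h

/-- If the loop gain at zero frequency has no eigenvalue in `[1, ∞)`, the loop is stable. -/
theorem isHurwitz_closedLoop (hS₁ : S₁.IsMinimalRealization G)
    (hS₂ : S₂.IsMinimalRealization H) (hG : G.IsNegativeImaginary)
    (hH : H.IsStrictlyNegativeImaginary) (h12 : S₁.D * S₂.D = 0) (h21 : S₂.D * S₁.D = 0)
    (hlt : ∀ x ∈ spectrum ℝ (G.dcGain * H.dcGain), x < 1) : IsHurwitz (S₁.closedLoop S₂) := by
  have hax (κ : ℝ) (hκ : 0 < κ) (hκ1 : κ ≤ 1) (s : ℂ) (hs : s.re = 0) :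
      (pencil (S₁.closedLoop (S₂.scale κ)) s).det ≠ 0 := by
    refine det_pencil_closedLoop_ne_zero_of_re_eq_zero hS₁ hS₂ hG hH h12 h21 hκ (fun y hy => ?_) hs
    -- A fixed vector of κG(0)H(0) is an eigenvector of G(0)H(0) for 1/κ ≥ 1.
    by_contra hy0
    have hdet : (pencil (G.dcGain * H.dcGain) (κ⁻¹ : ℝ)).det = 0 := by
      refine Matrix.exists_mulVec_eq_zero_iff.1 ⟨y, hy0, ?_⟩
      rw [pencil_mulVec, map_mul_mulVec, dcGain_map, dcGain_map, sub_eq_zero]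
      conv_lhs => rw [← hy]
      rw [smul_smul, ← Complex.ofReal_mul, inv_mul_cancel₀ hκ.ne', Complex.ofReal_one, one_smul]
    have := hlt _ ((mem_spectrum_real_iff _ _).2 hdet)
    exact absurd this (not_lt.2 ((one_le_inv₀ hκ).2 hκ1))
  obtain ⟨κ, hκ, hκ1, hst⟩ := exists_isHurwitz_closedLoop_scale hS₁ hS₂ hG hH h12 h21 hax
  have := IsHurwitz.of_path (continuous_closedLoop_scale h12 h21) hκ1
    (fun κ' hκ' => hax κ' (hκ.trans_le hκ'.1) hκ'.2) hst
  rwa [scale_one] at this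

/-- If the loop is stable, the loop gain at zero frequency has no eigenvalue in `[1, ∞)`. -/
theorem lt_one_of_isHurwitz_closedLoop (hS₁ : S₁.IsMinimalRealization G)
    (hS₂ : S₂.IsMinimalRealization H) (hG : G.IsNegativeImaginary)
    (hH : H.IsStrictlyNegativeImaginary) (h12 : S₁.D * S₂.D = 0) (h21 : S₂.D * S₁.D = 0)
    (hD : S₂.D.PosSemidef) (hH0 : H.dcGain.PosSemidef) (hst : IsHurwitz (S₁.closedLoop S₂))
    {l : ℝ} (hl : l ∈ spectrum ℝ (G.dcGain * H.dcGain)) : l < 1 := by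
  by_contra! hl1
  obtain ⟨v, hv, hv0⟩ : ∃ v, v ≠ 0 ∧ (G.dcGain * H.dcGain) *ᵥ v = l • v := by
    rw [Matrix.mem_spectrum_iff_isRoot_charpoly, IsRoot, Matrix.eval_charpoly] at hl
    obtain ⟨v, hv, h⟩ := Matrix.exists_mulVec_eq_zero_iff.2 hl
    refine ⟨v, hv, ?_⟩
    rw [Matrix.sub_mulVec, sub_eq_zero] at h
    rw [← h]
    ext i
    simp [Matrix.mulVec_diagonal]
  rw [← Matrix.mulVec_mulVec] at hv0
  have hA₁0 := hS₁.det_pencil_ne_zero hG.no_pole_zero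
  have hA₂ {s : ℂ} (hs : 0 ≤ s.re) := hS₂.det_pencil_ne_zero (hH.no_pole s hs)
  rw [isHurwitz_iff] at hst
  -- Chosen so that at s = 0 the loop settles at y₁ = l v and the input of the second system is y₁ +
  -- r = v.
  let r : Fin m → ℝ := (1 - l) • v
  have hfreq (ω : ℝ) (hω : 0 < ω) : (transferForm (S₁.closedLoop S₂) (loopInput S₁ S₂)
      (loopOutput S₁ S₂) S₂.D r (Complex.I * ω)).im ≤ 0 := by
    have hd := hst (Complex.I * ω) (by simp)
    let x := (pencil (S₁.closedLoop S₂) (Complex.I * ω))⁻¹ *ᵥ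
      ((loopInput S₁ S₂).map (algebraMap ℝ ℂ) *ᵥ (algebraMap ℝ ℂ ∘ r))
    have hx : pencil (S₁.closedLoop S₂) (Complex.I * ω) *ᵥ x =
      (loopInput S₁ S₂).map (algebraMap ℝ ℂ) *ᵥ (algebraMap ℝ ℂ ∘ r) := pencil_mulVec_inv_pencil hd _
    obtain ⟨x₁, x₂, hx12⟩ : ∃ x₁ x₂, x = Sum.elim x₁ x₂ := ⟨_, _, (Sum.elim_comp_inl_inr x).symm⟩
    obtain ⟨y₁, y₂, hy₁, hy₂⟩ := exists_loop_signals h12 h21 x₁ x₂ (algebraMap ℝ ℂ ∘ r)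
    obtain ⟨hiff, hout⟩ := pencil_closedLoop_mulVec_iff h12 h21 hy₁ hy₂ (s := Complex.I * ω)
    rw [← hx12] at hiff hout
    obtain ⟨e1, e2⟩ := hiff.1 hx
    rw [transferForm, mul_inv_pencil_mulVec _ _ hd hx, hout]
    have hA := hA₂ (s := Complex.I * ω) (by simp)
    have h2 : y₂ = H.evalAt (Complex.I * ω) *ᵥ (y₁ + algebraMap ℝ ℂ ∘ r) := by
      rw [← hS₂.value_eq hA, value, mul_inv_pencil_mulVec _ _ hA e2]
      exact hy₂
    -- Im r*y₂ = Im (y₁ + r)*y₂ + Im y₂*y₁, where the first term is nonpositive by H and the second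
    -- by G.
    have i1 := hS₁.im_star_dotProduct_output_nonpos hG hω e1
    rw [← hy₁] at i1
    have i2 := im_star_dotProduct_mulVec_nonpos (hH.freq_pos ω hω).posSemidef
      (y₁ + algebraMap ℝ ℂ ∘ r)
    rw [← h2, star_add, add_dotProduct, star_comp_algebraMap, Complex.add_im,
      Matrix.star_dotProduct y₁] at i2
    have i3 : (star (star y₂ ⬝ᵥ y₁)).im = -(star y₂ ⬝ᵥ y₁).im := Complex.conj_im _
    linarith
  have hle := dotProduct_le_re_transferForm_zero _ _ _ r hst hfreq
  have hd0 := hst 0 le_rfl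
  have hA₂0 := hA₂ (s := 0) le_rfl
  let vc : Fin m → ℂ := algebraMap ℝ ℂ ∘ v
  let y₂ : Fin m → ℂ := algebraMap ℝ ℂ ∘ (H.dcGain *ᵥ v)
  let y₁ : Fin m → ℂ := algebraMap ℝ ℂ ∘ (l • v)
  have hsum : y₁ + algebraMap ℝ ℂ ∘ r = vc := by
    ext i
    simp [y₁, r, vc]
    ring
  let x₁ := (pencil S₁.A 0)⁻¹ *ᵥ (S₁.B.map (algebraMap ℝ ℂ) *ᵥ y₂)
  let x₂ := (pencil S₂.A 0)⁻¹ *ᵥ (S₂.B.map (algebraMap ℝ ℂ) *ᵥ (y₁ + algebraMap ℝ ℂ ∘ r))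
  have e1 : pencil S₁.A 0 *ᵥ x₁ = S₁.B.map (algebraMap ℝ ℂ) *ᵥ y₂ :=
    pencil_mulVec_inv_pencil hA₁0 _
  have e2 : pencil S₂.A 0 *ᵥ x₂ = S₂.B.map (algebraMap ℝ ℂ) *ᵥ (y₁ + algebraMap ℝ ℂ ∘ r) :=
    pencil_mulVec_inv_pencil hA₂0 _
  have hy₁ : y₁ = S₁.C.map (algebraMap ℝ ℂ) *ᵥ x₁ + S₁.D.map (algebraMap ℝ ℂ) *ᵥ y₂ := by
    rw [← mul_inv_pencil_mulVec S₁.C S₁.D hA₁0 e1]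
    have := hS₁.value_eq hA₁0
    rw [value] at this
    rw [this, ← dcGain_map, ← map_mulVec_comp, hv0]
  have hy₂ : y₂ = S₂.C.map (algebraMap ℝ ℂ) *ᵥ x₂ +
      S₂.D.map (algebraMap ℝ ℂ) *ᵥ (y₁ + algebraMap ℝ ℂ ∘ r) := by
    rw [← mul_inv_pencil_mulVec S₂.C S₂.D hA₂0 e2]
    have := hS₂.value_eq hA₂0
    rw [value] at this
    rw [this, hsum, ← dcGain_map, ← map_mulVec_comp]
  obtain ⟨hiff, hout⟩ := pencil_closedLoop_mulVec_iff h12 h21 hy₁ hy₂ (s := 0)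
  have hT := (mul_inv_pencil_mulVec (loopOutput S₁ S₂) S₂.D hd0 (hiff.2 ⟨e1, e2⟩)).trans hout
  have hform : (transferForm (S₁.closedLoop S₂) (loopInput S₁ S₂) (loopOutput S₁ S₂) S₂.D r 0).re =
      (1 - l) * (v ⬝ᵥ H.dcGain *ᵥ v) := by
    rw [transferForm, hT, comp_dotProduct_comp, Complex.ofReal_re, smul_dotProduct, smul_eq_mul]
  have hDr := hD.dotProduct_mulVec_nonneg r
  have hHv := hH0.dotProduct_mulVec_nonneg v
  rw [star_trivial] at hDr hHv
  rw [hform] at hle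
  -- For l = 1 the inequality is void, but r = 0 makes the response y₂ = H(0)v zero. For l > 1 it
  -- reads 0 ≤ rᵀD₂r ≤ (1 - l) vᵀH(0)v, which forces vᵀH(0)v = 0.
  have hHv0 : H.dcGain *ᵥ v = 0 := by
    rcases hl1.eq_or_lt with rfl | hl1
    · have hr : algebraMap ℝ ℂ ∘ r = 0 := by ext; simp [r]
      rw [hr, Matrix.mulVec_zero] at hT
      ext i
      simpa [y₂] using (congrFun hT i).symm
    · refine (hH0.dotProduct_mulVec_zero_iff v).1 ?_
      rw [star_trivial]
      nlinarith
  rw [hHv0, Matrix.mulVec_zero] at hv0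
  rcases smul_eq_zero.1 hv0.symm with h | h
  · linarith
  · exact hv h

end StateSpace

/-! ### Assembly of the corollary -/

theorem TransferMatrix.IsNegativeImaginary.isSymm_D {S : StateSpace n m} {G : TransferMatrix m}
    (hS : S.IsMinimalRealization G) (hG : G.IsNegativeImaginary) : S.D.IsSymm := by
  rw [← hS.1] at hG
  exact S.isSymm_D hG.freq_nonneg

theorem TransferMatrix.IsNegativeImaginary.isSymm_dcGain {S : StateSpace n m}
    {G : TransferMatrix m} (hS : S.IsMinimalRealization G) (hG : G.IsNegativeImaginary) :
    G.dcGain.IsSymm := by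
  have h0 := hS.det_pencil_ne_zero hG.no_pole_zero
  rw [← hS.1] at hG ⊢
  exact S.isSymm_dcGain h0 hG.freq_nonneg

theorem TransferMatrix.IsStrictlyNegativeImaginary.posSemidef_dcGain {S : StateSpace n m}
    {H : TransferMatrix m} (hS : S.IsMinimalRealization H) (hH : H.IsStrictlyNegativeImaginary)
    (hD : S.D.PosSemidef) : H.dcGain.PosSemidef := by
  have h0 := hS.det_pencil_ne_zero (hH.no_pole 0 le_rfl)
  have hsymm : H.dcGain.IsSymm := by
    rw [← hS.1] at hH ⊢
    exact S.isSymm_dcGain h0 fun ω hω _ => (hH.freq_pos ω hω).posSemidef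
  refine Matrix.PosSemidef.of_dotProduct_mulVec_nonneg (by simpa using hsymm) fun u => ?_
  rw [star_trivial]
  have h1 := hD.dotProduct_mulVec_nonneg u
  rw [star_trivial] at h1
  exact h1.trans (hS.dotProduct_D_le_dcGain hH u)

end NegImag

end

theorem mainTheorem2 {m : ℕ} (G H : NegImag.TransferMatrix m)
    (hGproper : G.IsProper) (hHproper : H.IsProper)
    (hG : G.IsNegativeImaginary) (hH : H.IsStrictlyNegativeImaginary)
    (hGH : G.atInfinity * H.atInfinity = 0) (hHinf : H.atInfinity.PosSemidef) :
    (∀ μ ∈ NegImag.complexSpectrum (G.dcGain * H.dcGain), μ.im = 0) ∧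
    (NegImag.InternallyStable G H ↔ NegImag.lambdaMax (G.dcGain * H.dcGain) < 1) := by
  have hD {n : ℕ} {F : NegImag.TransferMatrix m} {S : NegImag.StateSpace n m}
      (hF : F.IsProper) (hS : S.IsMinimalRealization F) : S.D = F.atInfinity := by
    obtain ⟨rfl, -⟩ := hS
    exact S.D_eq_atInfinity hF
  obtain ⟨n₁, S₁, hS₁⟩ := NegImag.exists_isMinimalRealization hGproper
  obtain ⟨n₂, S₂, hS₂⟩ := NegImag.exists_isMinimalRealization hHproper
  have hH0 : H.dcGain.PosSemidef := hH.posSemidef_dcGain hS₂ (hD hHproper hS₂ ▸ hHinf)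
  -- Both values at infinity are symmetric, so the product in the other order is the transpose of
  -- the given one.
  have hHG : H.atInfinity * G.atInfinity = 0 := by
    have hGs : G.atInfinity.IsSymm := hD hGproper hS₁ ▸ hG.isSymm_D hS₁
    have hHs : H.atInfinity.IsSymm := by simpa using hHinf.1
    have := congrArg Matrix.transpose hGH
    rwa [Matrix.transpose_mul, hGs.eq, hHs.eq, Matrix.transpose_zero] at this
  refine ⟨fun μ hμ => NegImag.im_eq_zero_of_mem_complexSpectrum_mul (hG.isSymm_dcGain hS₁) hH0 hμ, ?_⟩
  rw [NegImag.lambdaMax_lt_one_iff]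
  constructor
  · rintro ⟨-, h⟩ l hl
    refine NegImag.StateSpace.lt_one_of_isHurwitz_closedLoop hS₁ hS₂ hG hH ?_ ?_ ?_ hH0
      (h _ _ _ _ hS₁ hS₂).2 hl
    · rw [hD hGproper hS₁, hD hHproper hS₂, hGH]
    · rw [hD hGproper hS₁, hD hHproper hS₂, hHG]
    · rwa [hD hHproper hS₂]
  · intro hlt
    refine ⟨⟨n₁, n₂, S₁, S₂, hS₁, hS₂⟩, fun k₁ k₂ T₁ T₂ hT₁ hT₂ => ?_⟩
    have h12 : T₁.D * T₂.D = 0 := by rw [hD hGproper hT₁, hD hHproper hT₂, hGH]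
    have h21 : T₂.D * T₁.D = 0 := by rw [hD hGproper hT₁, hD hHproper hT₂, hHG]
    refine ⟨?_, NegImag.StateSpace.isHurwitz_closedLoop hT₁ hT₂ hG hH h12 h21 hlt⟩
    rw [NegImag.StateSpace.WellPosed, h12, sub_zero]
    exact isUnit_one
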